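/- Let $0<\epsilon\le 1$, let $K=\lceil 1/\epsilon^{2}\rceil$ (so $K=1/\epsilon^2$ whenever this is an integer), and let $\mathcal X_\epsilon=\{x_1,\dots,x_K\}$ with $x_i=i/K$. Let $F_1,\dots,F_T:[0,1]\to[0,1]$ be a random sequence of convex functions, drawn from an arbitrary probability distribution $\mathcal F$ over such sequences (the prior; arbitrary dependence between the $F_t$ is allowed; the $\sigma$-algebra on loss functions is generated by the evaluations at points of $[0,1]$). Let $X^\star=\operatorname{argmin}_{x\in\mathcal X_\epsilon}\sum_{t=1}^T F_t(x)$. A player who knows $\mathcal F$ chooses in each round $t=1,\dots,T$ a random point $X_t\in\mathcal X_\epsilon$ and then observes only $F_t(X_t)$. Let $\mathcal H_{t-1}$ be the $\sigma$-algebra generated by $X_s$ and $F_s(X_s)$, $s<t$, and let $\Pr_t$ and $\mathbb E_t$ denote probability and expectation conditional on $\mathcal H_{t-1}$. The modified Thompson Sampling algorithm computes in round $t$ $$\alpha_{i,t}=\Pr\nolimits_t(X^\star=x_i),\qquad f_t(x_i)=\mathbb E_t[F_t(x_i)],\qquad f_{j,t}(x_i)=\mathbb E_t[F_t(x_i)\mid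 X^\star=x_j],$$ an index $i_t^\star\in\operatorname{argmin}_i f_t(x_i)$, and the set $$S_t=\{i\in\{1,\dots,K\}:\ f_{i,t}(x_i)\le f_t(x_{i_t^\star})\ \text{ and }\ \alpha_{i,t}\ge \epsilon/K\},$$ and then, given the history and independently of everything else, it plays $X_t=x_i$ with probability $$\pi_{i,t}=\tfrac12\,\alpha_{i,t}\,\mathbf 1\{i\in S_t\}+\Bigl(1-\tfrac12\sum_{j\in S_t}\alpha_{j,t}\Bigr)\mathbf 1\{i=i_t^\star\}.$$ Ties in each argmin are broken by an arbitrary measurable rule that selects a minimizing index from the vector of values being minimized (the rule for $i_t^\star$ may depend on $t$). Then, for every $T$, every prior $\mathcal F$ and every such $\epsilon$, the Bayesian regret of this algorithm over $\mathcal X_\epsilon$ satisfies $$\mathbb E\Bigl[\sum_{t=1}^T F_t(X_t)-\sum_{t=1}^T F_t(X^\star)\Bigr]\ \le\ 10\sqrt T\,\log\frac{2K}{\epsilon}+10\,\epsilon\, T\sqrt{\log\frac{2K}{\epsilon}}.$$ In particular, for $\epsilon=1/\sqrt T$ this regret is $O(\sqrt T\log T)$: there is an absolute constant $C$ such that, for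 all $T\ge 2$ and all priors, it is at most $C\sqrt T\log T$. -/

import Mathlib

open MeasureTheory

noncomputable section

namespace ConvexBandit

/-- A convex loss function `[0,1] → [0,1]`, represented by a function on `ℝ` of which only the values
on `[0,1]` are ever used. -/
structure ConvexLoss where
  toFun : ℝ → ℝ
  convexOn : ConvexOn ℝ (Set.Icc (0 : ℝ) 1) toFun
  mem_Icc : ∀ x ∈ Set.Icc (0 : ℝ) 1, toFun x ∈ Set.Icc (0 : ℝ) 1

/-- The sigma-algebra on loss functions generated by the evaluations at the points of `[0,1]`.
A prior is a probability measure on `Fin T → ConvexLoss` with the product sigma-algebra. -/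
instance : MeasurableSpace ConvexLoss :=
  ⨆ x : Set.Icc (0 : ℝ) 1, MeasurableSpace.comap (fun f : ConvexLoss => f.toFun x) inferInstance

/-- The number of grid points, `1 / ε ^ 2`, rounded up when this is not an integer. -/
def gridSize (ε : ℝ) : ℕ := ⌈1 / ε ^ 2⌉₊

/-- The points `1/K, 2/K, …, K/K` of the grid. -/
def gridPoint (K : ℕ) (i : Fin K) : ℝ := ((i : ℝ) + 1) / K

/-- A measurable rule that selects a minimizing index of a vector: `argmin` with a rule for ties. -/
structure ArgminRule (K : ℕ) where
  sel : (Fin K → ℝ) → Fin K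
  measurable_sel : Measurable sel
  sel_le : ∀ (v : Fin K → ℝ) (i : Fin K), v (sel v) ≤ v i

/-- What the player has seen in `n` rounds: the chosen arms and the observed losses. -/
abbrev History (K n : ℕ) : Type := Fin n → Fin K × ℝ

/-- The whole loss sequence, together with the history of the first `n` rounds. -/
abbrev State (T K n : ℕ) : Type := (Fin T → ConvexLoss) × History K n

/-- The loss function of round `n` (rounds are numbered `0, …, T - 1`; the value for `n ≥ T` is
never used). -/
def lossAt {T : ℕ} (F : Fin T → ConvexLoss) (n : ℕ) (x : ℝ) : ℝ :=
  if h : n < T then (F ⟨n, h⟩).toFun x else 0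

/-- The index of the best grid point in hindsight, `X⋆`. -/
def hindsight {T K : ℕ} (opt : ArgminRule K) (F : Fin T → ConvexLoss) : Fin K :=
  opt.sel fun i => ∑ t, (F t).toFun (gridPoint K i)

open Classical in
/-- The indicator of the event that `X⋆` is the grid point number `i`. -/
def hindsightInd {T K n : ℕ} (opt : ArgminRule K) (i : Fin K) (s : State T K n) : ℝ :=
  if hindsight opt s.1 = i then 1 else 0

/-- The sigma-algebra generated by the history of the first `n` rounds. -/
abbrev historyAlg (T K n : ℕ) : MeasurableSpace (State T K n) :=
  MeasurableSpace.comap Prod.snd inferInstance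

section Round

/-! One round of the algorithm, after `n` rounds have been played. `P` is the joint law of the loss
sequence and of the history so far. -/

variable {T K n : ℕ} (P : Measure (State T K n)) (ε : ℝ) (opt best : ArgminRule K)

/-- The posterior probability `α i` that `X⋆` is the grid point number `i`. -/
def posterior (i : Fin K) : State T K n → ℝ :=
  P[hindsightInd opt i | historyAlg T K n]

/-- The conditional expectation `f (x i)` of the coming loss at grid point `i`, given the history. -/
def meanLoss (i : Fin K) : State T K n → ℝ :=
  P[fun s => lossAt s.1 n (gridPoint K i) | historyAlg T K n]

/-- The conditional expectation `f_j (x i)` of the coming loss at grid point `i`, given the history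
and the event that `X⋆` is the grid point number `j`. (Where this event has posterior probability
zero, the value is never used.) -/
def meanLossGiven (j i : Fin K) (s : State T K n) : ℝ :=
  (P[fun s => lossAt s.1 n (gridPoint K i) * hindsightInd opt j s | historyAlg T K n]) s
    / posterior P opt j s

/-- The arm `i⋆` of smallest expected loss given the history. -/
def bestArm (s : State T K n) : Fin K :=
  best.sel fun i => meanLoss P i s

open Classical in
/-- The set `S` of arms worth exploring. -/
def exploreSet (s : State T K n) : Finset (Fin K) :=
  Finset.univ.filter fun i =>
    meanLossGiven P opt i i s ≤ meanLoss P (bestArm P best s) s ∧ ε / K ≤ posterior P opt i s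

open Classical in
/-- The probability `π i` with which the algorithm plays arm `i`. -/
def playProb (i : Fin K) (s : State T K n) : ℝ :=
  1 / 2 * posterior P opt i s * (if i ∈ exploreSet P ε opt best s then 1 else 0)
    + (1 - 1 / 2 * ∑ j ∈ exploreSet P ε opt best s, posterior P opt j s)
      * (if i = bestArm P best s then 1 else 0)

end Round

/-- The joint law of the loss sequence `F` and of the history of the first `n` rounds, when `F` is
drawn from the prior and then the algorithm is run: in every round an arm `i` is drawn with the
probabilities `playProb`, and the pair of `i` and its loss is appended to the history. -/
def gameLaw {T K : ℕ} (prior : Measure (Fin T → ConvexLoss)) (ε : ℝ)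
    (opt : ArgminRule K) (best : ℕ → ArgminRule K) : (n : ℕ) → Measure (State T K n)
  | 0 => prior.map fun F => (F, Fin.elim0)
  | n + 1 => ∑ i : Fin K,
      ((gameLaw prior ε opt best n).withDensity fun s =>
          ENNReal.ofReal (playProb (gameLaw prior ε opt best n) ε opt (best n) i s)).map
        fun s => (s.1, Fin.snoc s.2 (i, lossAt s.1 n (gridPoint K i)))

/-- The Bayesian regret of the algorithm over the grid: the expectation of
`∑ t, F t (X t) - ∑ t, F t X⋆` after all `T` rounds. -/
def bayesRegret {T K : ℕ} (prior : Measure (Fin T → ConvexLoss)) (ε : ℝ)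
    (opt : ArgminRule K) (best : ℕ → ArgminRule K) : ℝ :=
  ∫ s, (∑ t, (s.1 t).toFun (gridPoint K (s.2 t).1)
      - ∑ t, (s.1 t).toFun (gridPoint K (hindsight opt s.1))) ∂(gameLaw prior ε opt best T)

end ConvexBandit

end

/-!
The regret of one round is compared with the information that the round reveals about `X⋆`, and
the total information is bounded by the entropy of `X⋆`, which is at most `log K`.

*One round.* Fix the history, and let `α`, `f`, `g j` be the posterior, the mean loss and the mean
loss given that `X⋆` is arm `j`; let `b` be the best arm for `f`, and let
`V = ∑ i, p i * ∑ j, α j * (g j i - f i) ^ 2`, where `p` are the probabilities of playing the arms.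
Up to `ε`, the regret of the round is at most `∑ j ∈ S, α j * (f j - g j j)`, since the arms outside
`S` have nothing to gain or are improbable. For `j ∈ S` the value of the convex function `g j` at `j`
is at most the minimum of the convex function `f`. Hence, unless the two differ already at `b`, they
differ at every arm `i` between `b` and `j`, up to `ε` by at least the fraction
`(u i + ε * d i) / (u j + ε * d j)` of the gap at `j`; here `u i = f i - f b` and `d i` is the
distance from `i` to `b`. The Cauchy-Schwarz inequality with the masses `α i * (u i + ε * d i) ^ 2`
costs only a factor logarithmic in the ratio of the total to the least mass
(`sum_div_prefix_sum_le`, `sq_sum_gap_le`). As the algorithm plays `b` at least half of the time and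
every arm of `S` with at least half of its posterior probability, the square of the sum over `S` is
at most a multiple of `log (2 * K / ε) * (V + ε ^ 2)` (`sq_sum_gap_le_information`).

*All rounds.* The expectation of `V` is at most the decrease of the expected entropy of the
posterior (`IsStrategy.integral_roundInfo_le`). Indeed `α j * (g j i - f i)` is the conditional
covariance of the observed loss with the new posterior probability of `j`, and a covariance with a
bounded variable is controlled by the Hellinger distance between the old and the new posterior,
hence by their relative entropy (`deviation_mul_le`). The law of the state after a round is
computed with `playStep`, and the two estimates are added up by induction on the number of rounds.
-/

noncomputable section

namespace ConvexBandit

/-! ### Sums weighted by prefix masses -/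

open Classical in
/-- Dividing each mass `β j` by the mass of everything not farther than `j` gives a sum of only
logarithmic size: adding the farthest index `a` adds `β a / total`, which is at most the increase of
`log total`. -/
theorem sum_div_prefix_sum_le {ι : Type*} (s : Finset ι) (d β : ι → ℝ) {m : ℝ} (hm : 0 < m)
    (hs : s.Nonempty) (hβ : ∀ i ∈ s, m ≤ β i) :
    ∑ j ∈ s, β j / ∑ i ∈ s with d i ≤ d j, β i ≤ 1 + Real.log ((∑ i ∈ s, β i) / m) := by
  induction s using Finset.induction_on_max_value d with
  | empty => simp at hs
  | insert a s ha hmax ih =>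
    have hβa : m ≤ β a := hβ a (by simp)
    have hβs : ∀ i ∈ s, m ≤ β i := fun i hi => hβ i (by simp [hi])
    have hfa : ({i ∈ insert a s | d i ≤ d a}) = insert a s := by
      apply Finset.filter_true_of_mem
      intro x hx
      rcases Finset.mem_insert.1 hx with rfl | hx
      · exact le_rfl
      · exact hmax x hx
    rw [Finset.sum_insert ha, hfa]
    rcases s.eq_empty_or_nonempty with rfl | hne
    · simp only [insert_empty_eq, Finset.sum_singleton, Finset.sum_empty, add_zero]
      rw [div_self (by linarith)]
      have := Real.log_nonneg ((one_le_div hm).2 hβa)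
      linarith
    · have ih' := ih hne hβs
      have hle : ∑ j ∈ s, β j / ∑ i ∈ insert a s with d i ≤ d j, β i
          ≤ ∑ j ∈ s, β j / ∑ i ∈ s with d i ≤ d j, β i := by
        refine Finset.sum_le_sum fun j hj => ?_
        have hpos : 0 < ∑ i ∈ s with d i ≤ d j, β i :=
          Finset.sum_pos (fun i hi => hm.trans_le (hβs i (Finset.mem_filter.1 hi).1))
            ⟨j, by simp [hj]⟩
        refine div_le_div_of_nonneg_left (hm.le.trans (hβs j hj)) hpos ?_
        refine Finset.sum_le_sum_of_subset_of_nonneg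
          (Finset.filter_subset_filter _ (Finset.subset_insert a s)) fun i hi _ => ?_
        exact hm.le.trans (hβ i (Finset.mem_filter.1 hi).1)
      have hS : 0 < ∑ i ∈ s, β i := Finset.sum_pos (fun i hi => hm.trans_le (hβs i hi)) hne
      rw [Finset.sum_insert ha]
      set S := ∑ i ∈ s, β i
      have hb : 0 < β a := hm.trans_le hβa
      have hlog : β a / (β a + S) + Real.log (S / m) ≤ Real.log ((β a + S) / m) := by
        rw [Real.log_div hS.ne' hm.ne', Real.log_div (by positivity) hm.ne']
        have h1 := Real.log_le_sub_one_of_pos (show 0 < S / (β a + S) by positivity)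
        rw [Real.log_div hS.ne' (by positivity)] at h1
        have h2 : S / (β a + S) - 1 = -(β a / (β a + S)) := by field_simp; ring
        linarith
      linarith

/-! ### One side of the best arm -/

/-- The information inequality for the arms on one side of the best arm, in abstract form. The arm
`j` is at distance `d j` from the best arm and has the gap `u j` under the mean loss, and its
conditional loss lies `w j` below the minimum of the mean loss. The mean loss and the loss given `j`
differ by `I i j` at `i` and by `e j` at the best arm; `hslope` and `hI` express that both are
convex.
The Cauchy-Schwarz inequality is applied with the masses `a i * (u i + ε * d i) ^ 2`, for which the
loss is only logarithmic; the term `ε * d i` keeps the least mass away from zero. -/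
theorem sq_sum_gap_le {ι : Type*} (R : Finset ι) (a u w d e : ι → ℝ) (I : ι → ι → ℝ) {ε K : ℝ}
    (hε : 0 < ε) (hε1 : ε ≤ 1) (hK : 1 ≤ K) (ha : ∀ i ∈ R, ε / K ≤ a i) (hsum : ∑ i ∈ R, a i ≤ 1)
    (hu0 : ∀ i ∈ R, 0 ≤ u i) (hu1 : ∀ i ∈ R, u i ≤ 1) (hw : ∀ i ∈ R, 0 ≤ w i)
    (hd : ∀ i ∈ R, 1 / K ≤ d i) (hd1 : ∀ i ∈ R, d i ≤ 1)
    (hslope : ∀ i ∈ R, ∀ j ∈ R, d i ≤ d j → u i * d j ≤ u j * d i)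
    (hI : ∀ i ∈ R, ∀ j ∈ R, d i ≤ d j → u i + d i / d j * w j ≤ I i j + e j) :
    (∑ j ∈ R, a j * (u j + w j)) ^ 2
      ≤ (1 + Real.log (4 * (K / ε) ^ 3))
        * (3 * (∑ j ∈ R, a j * (∑ i ∈ R, a i * I i j ^ 2 + e j ^ 2) + ε ^ 2)) := by
  classical
  have hK0 : 0 < K := by linarith
  have hapos : ∀ i ∈ R, 0 < a i := fun i hi => (by positivity : 0 < ε / K).trans_le (ha i hi)
  have hdpos : ∀ i ∈ R, 0 < d i := fun i hi => (by positivity : 0 < 1 / K).trans_le (hd i hi)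
  have hM : 0 ≤ 1 + Real.log (4 * (K / ε) ^ 3) := by
    have : 1 ≤ K / ε := by rw [one_le_div hε]; linarith
    have := Real.log_nonneg (by nlinarith [one_le_pow₀ this (n := 3)] : 1 ≤ 4 * (K / ε) ^ 3)
    linarith
  have hQ : 0 ≤ ∑ j ∈ R, a j * (∑ i ∈ R, a i * I i j ^ 2 + e j ^ 2) :=
    Finset.sum_nonneg fun j hj => mul_nonneg (hapos j hj).le (add_nonneg
      (Finset.sum_nonneg fun i hi => mul_nonneg (hapos i hi).le (sq_nonneg _)) (sq_nonneg _))
  rcases R.eq_empty_or_nonempty with rfl | hne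
  · simp only [Finset.sum_empty] at hQ ⊢
    rw [zero_pow two_ne_zero]
    exact mul_nonneg hM (by positivity)
  let v : ι → ℝ := fun i => u i + ε * d i
  have hv : ∀ i ∈ R, 0 < v i := fun i hi =>
    add_pos_of_nonneg_of_pos (hu0 i hi) (mul_pos hε (hdpos i hi))
  let β : ι → ℝ := fun i => a i * v i ^ 2
  have hβ : ∀ i ∈ R, 0 < β i := fun i hi => mul_pos (hapos i hi) (pow_pos (hv i hi) 2)
  let P : ι → ℝ := fun j => ∑ i ∈ R with d i ≤ d j, β i
  have hP : ∀ j ∈ R, 0 < P j := fun j hj =>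
    Finset.sum_pos (fun i hi => hβ i (Finset.mem_filter.1 hi).1) ⟨j, by simp [hj]⟩
  have hCS := Finset.sum_sq_le_sum_mul_sum_of_sq_le_mul R (r := fun j => a j * (u j + w j))
    (f := fun j => β j / P j) (g := fun j => a j * (P j / v j ^ 2 * (u j + w j) ^ 2))
    (fun j hj => (div_pos (hβ j hj) (hP j hj)).le)
    (fun j hj => by have := hapos j hj; have := hP j hj; positivity)
    (fun j hj => by
      have h1 := (hP j hj).ne'
      have h2 := (hv j hj).ne'
      simp only [β]
      apply le_of_eq
      field_simp)
  refine hCS.trans (mul_le_mul ?_ ?_ ?_ hM)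
  · have hm : 0 < (ε / K) ^ 3 := by positivity
    refine (sum_div_prefix_sum_le R d β hm hne fun i hi => ?_).trans ?_
    · have h1 : ε / K ≤ v i := by
        have := mul_le_mul_of_nonneg_left (hd i hi) hε.le
        have h2 := hu0 i hi
        have h3 : ε * (1 / K) = ε / K := by ring
        simp only [v]; linarith
      calc (ε / K) ^ 3 = (ε / K) * (ε / K) ^ 2 := by ring
        _ ≤ a i * v i ^ 2 := mul_le_mul (ha i hi) (pow_le_pow_left₀ (by positivity) h1 2)
          (by positivity) (hapos i hi).le
    · have hS : ∑ i ∈ R, β i ≤ 4 := by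
        calc ∑ i ∈ R, β i ≤ ∑ i ∈ R, a i * 4 := by
              refine Finset.sum_le_sum fun i hi => mul_le_mul_of_nonneg_left ?_ (hapos i hi).le
              have h1 : v i ≤ 2 := by
                have := hu1 i hi; have := hd1 i hi; have := hdpos i hi
                simp only [v]; nlinarith
              nlinarith [hv i hi]
          _ = (∑ i ∈ R, a i) * 4 := by rw [Finset.sum_mul]
          _ ≤ 4 := by linarith
      have hS0 : 0 < ∑ i ∈ R, β i := Finset.sum_pos hβ hne
      have : (∑ i ∈ R, β i) / (ε / K) ^ 3 ≤ 4 * (K / ε) ^ 3 := by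
        rw [div_le_iff₀ hm, mul_assoc, ← mul_pow]
        have : K / ε * (ε / K) = 1 := by field_simp
        rw [this]; linarith
      have := Real.log_le_log (by positivity) this
      linarith
  · have key : ∀ j ∈ R, a j * (P j / v j ^ 2 * (u j + w j) ^ 2)
        ≤ a j * (3 * (∑ i ∈ R, a i * I i j ^ 2 + e j ^ 2 + ε ^ 2)) := by
      intro j hj
      refine mul_le_mul_of_nonneg_left ?_ (hapos j hj).le
      have h1 : P j / v j ^ 2 * (u j + w j) ^ 2
          = ∑ i ∈ R with d i ≤ d j, a i * (v i / v j * (u j + w j)) ^ 2 := by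
        simp only [P, Finset.sum_div, Finset.sum_mul, β]
        refine Finset.sum_congr rfl fun i _ => ?_
        rw [mul_pow, div_pow, ← mul_assoc, mul_div_assoc]
      have h2 : ∀ i ∈ ({i ∈ R | d i ≤ d j} : Finset ι), a i * (v i / v j * (u j + w j)) ^ 2
          ≤ a i * (3 * (I i j ^ 2 + e j ^ 2 + ε ^ 2)) := by
        intro i hi
        obtain ⟨hi, hij⟩ := Finset.mem_filter.1 hi
        refine mul_le_mul_of_nonneg_left ?_ (hapos i hi).le
        have hvi := hv i hi
        have hvj := hv j hj
        have hdj := hdpos j hj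
        have huj := hu0 j hj
        have hwj := hw j hj
        have hρ : v i / v j ≤ d i / d j := by
          rw [div_le_div_iff₀ hvj hdj]
          have := hslope i hi j hj hij
          simp only [v]; linarith
        have hρu : v i / v j * u j ≤ v i := by
          rw [div_mul_eq_mul_div, div_le_iff₀ hvj]
          refine mul_le_mul_of_nonneg_left ?_ hvi.le
          have : 0 < ε * d j := by positivity
          simp only [v]; linarith
        have hρw := mul_le_mul_of_nonneg_right hρ hwj
        have hεd : ε * d i ≤ ε := by nlinarith [hd1 i hi]
        have hle : v i / v j * (u j + w j) ≤ I i j + e j + ε := by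
          have := hI i hi j hj hij
          have hvdef : v i = u i + ε * d i := rfl
          rw [mul_add]; linarith
        have h0 : 0 ≤ v i / v j * (u j + w j) := by positivity
        nlinarith [pow_le_pow_left₀ h0 hle 2, sq_nonneg (I i j - e j), sq_nonneg (I i j - ε),
          sq_nonneg (e j - ε)]
      rw [h1]
      calc _ ≤ ∑ i ∈ R with d i ≤ d j, a i * (3 * (I i j ^ 2 + e j ^ 2 + ε ^ 2)) :=
            Finset.sum_le_sum h2
        _ ≤ ∑ i ∈ R, a i * (3 * (I i j ^ 2 + e j ^ 2 + ε ^ 2)) := by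
            refine Finset.sum_le_sum_of_subset_of_nonneg (Finset.filter_subset _ _)
              fun i hi _ => mul_nonneg (hapos i hi).le (by positivity)
        _ = 3 * (∑ i ∈ R, a i * I i j ^ 2 + (∑ i ∈ R, a i) * (e j ^ 2 + ε ^ 2)) := by
            rw [Finset.sum_mul, ← Finset.sum_add_distrib, Finset.mul_sum]
            exact Finset.sum_congr rfl fun i _ => by ring
        _ ≤ _ := by nlinarith [sq_nonneg (e j), sq_nonneg ε]
    calc _ ≤ ∑ j ∈ R, a j * (3 * (∑ i ∈ R, a i * I i j ^ 2 + e j ^ 2 + ε ^ 2)) :=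
          Finset.sum_le_sum key
      _ = 3 * (∑ j ∈ R, a j * (∑ i ∈ R, a i * I i j ^ 2 + e j ^ 2) + (∑ j ∈ R, a j) * ε ^ 2) := by
          rw [Finset.sum_mul, ← Finset.sum_add_distrib, Finset.mul_sum]
          exact Finset.sum_congr rfl fun i _ => by ring
      _ ≤ _ := by nlinarith [sq_nonneg ε]
  · exact Finset.sum_nonneg fun j hj => by
      have := hapos j hj; have := hP j hj; positivity

/-! ### The regret of one round against the information it reveals -/

theorem gridPoint_mem_Icc {K : ℕ} (i : Fin K) : gridPoint K i ∈ Set.Icc (0 : ℝ) 1 := by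
  have hK : (0 : ℝ) < K := by exact_mod_cast i.pos
  have hi : ((i : ℕ) : ℝ) + 1 ≤ K := by exact_mod_cast i.isLt
  exact ⟨by unfold gridPoint; positivity, (div_le_one hK).2 hi⟩

theorem one_div_le_abs_gridPoint_sub {K : ℕ} {i j : Fin K} (h : i ≠ j) :
    1 / (K : ℝ) ≤ |gridPoint K i - gridPoint K j| := by
  have hK : (0 : ℝ) < K := by exact_mod_cast i.pos
  have h1 : gridPoint K i - gridPoint K j = (((i : ℕ) : ℤ) - ((j : ℕ) : ℤ) : ℤ) / (K : ℝ) := by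
    unfold gridPoint; push_cast; ring
  rw [h1, abs_div, abs_of_pos hK]
  gcongr
  have : ((i : ℕ) : ℤ) - ((j : ℕ) : ℤ) ≠ 0 := by
    rw [sub_ne_zero]; exact_mod_cast Fin.val_ne_of_ne h
  exact_mod_cast Int.one_le_abs this

/-- A vector of values at the grid points is convex if it satisfies the inequality of convexity
whenever a grid point `b` lies between two others, `a` and `c`, which divide the segment in the
ratio `t : 1 - t`. -/
def GridConvex {K : ℕ} (v : Fin K → ℝ) : Prop :=
  ∀ a b c : Fin K, a ≠ c →
    0 ≤ (gridPoint K b - gridPoint K a) / (gridPoint K c - gridPoint K a) →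
    (gridPoint K b - gridPoint K a) / (gridPoint K c - gridPoint K a) ≤ 1 →
    v b ≤ (1 - (gridPoint K b - gridPoint K a) / (gridPoint K c - gridPoint K a)) * v a
      + (gridPoint K b - gridPoint K a) / (gridPoint K c - gridPoint K a) * v c

/-- The information inequality for the arms of `R`, all of which lie on the same side of the best
arm `b` (`σ` is the sign of that side). If the conditional loss of `j` at `j` is at most the minimum
of the mean loss, then by convexity the two losses differ at all arms between `b` and `j`, unless they
differ at `b`. -/
theorem sq_sum_gap_le_of_sameSide {K : ℕ} {ε : ℝ} (hε : 0 < ε) (hε1 : ε ≤ 1) {α f : Fin K → ℝ}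
    {g : Fin K → Fin K → ℝ} {b : Fin K} (hα0 : ∀ i, 0 ≤ α i) (hα1 : ∑ i, α i = 1)
    (hf : ∀ i, f i ∈ Set.Icc (0 : ℝ) 1) (hfc : GridConvex f) (hgc : ∀ j, GridConvex (g j))
    (hb : ∀ i, f b ≤ f i) (R : Finset (Fin K)) (σ : ℝ)
    (hR : ∀ i ∈ R, i ≠ b ∧ σ * (gridPoint K i - gridPoint K b) = |gridPoint K i - gridPoint K b|)
    (hS : ∀ i ∈ R, g i i ≤ f b ∧ ε / K ≤ α i) :
    (∑ j ∈ R, α j * (f j - g j j)) ^ 2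
      ≤ (1 + Real.log (4 * (K / ε) ^ 3))
        * (3 * (∑ j ∈ R, α j * (∑ i ∈ R, α i * (f i - g j i) ^ 2 + |g j b - f b| ^ 2)
          + ε ^ 2)) := by
  have hK : (1 : ℝ) ≤ K := by exact_mod_cast b.pos
  have hK0 : (0 : ℝ) < K := by linarith
  let d : Fin K → ℝ := fun i => |gridPoint K i - gridPoint K b|
  have hd : ∀ i ∈ R, 1 / (K : ℝ) ≤ d i := fun i hi => one_div_le_abs_gridPoint_sub (hR i hi).1
  have hdpos : ∀ i ∈ R, 0 < d i := fun i hi => (by positivity : 0 < 1 / (K : ℝ)).trans_le (hd i hi)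
  have hratio : ∀ i ∈ R, ∀ j ∈ R,
      (gridPoint K i - gridPoint K b) / (gridPoint K j - gridPoint K b) = d i / d j := by
    intro i hi j hj
    have hσ : σ ≠ 0 := by
      rintro rfl
      have := hdpos i hi
      simp only [d, ← (hR i hi).2, zero_mul, lt_irrefl] at this
    simp only [d, ← (hR i hi).2, ← (hR j hj).2, mul_div_mul_left _ _ hσ]
  have hconv : ∀ v : Fin K → ℝ, GridConvex v → ∀ i ∈ R, ∀ j ∈ R, d i ≤ d j →
      v i ≤ (1 - d i / d j) * v b + d i / d j * v j := by
    intro v hv i hi j hj hij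
    have h := hv b i j (Ne.symm (hR j hj).1)
    rw [hratio i hi j hj] at h
    exact h (div_nonneg (hdpos i hi).le (hdpos j hj).le) ((div_le_one (hdpos j hj)).2 hij)
  have hsum : ∑ i ∈ R, α i ≤ 1 := by
    rw [← hα1]
    exact Finset.sum_le_univ_sum_of_nonneg hα0
  have h := sq_sum_gap_le R α (fun i => f i - f b) (fun j => f b - g j j) d
    (fun j => |g j b - f b|) (fun i j => f i - g j i) hε hε1 hK (fun i hi => (hS i hi).2) hsum
    (fun i _ => by linarith [hb i]) (fun i _ => by linarith [(hf i).2, (hf b).1])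
    (fun i hi => by linarith [(hS i hi).1]) hd
    (fun i _ => by
      have h1 := gridPoint_mem_Icc i
      have h2 := gridPoint_mem_Icc b
      exact abs_le.2 ⟨by linarith [h1.1, h2.2], by linarith [h1.2, h2.1]⟩)
    (fun i hi j hj hij => by
      have h1 := hconv f hfc i hi j hj hij
      have h2 : f i - f b ≤ (f j - f b) * d i / d j := by
        rw [mul_div_assoc]; linarith
      exact (le_div_iff₀ (hdpos j hj)).1 h2)
    (fun i hi j hj hij => by
      have h1 := hconv (g j) (hgc j) i hi j hj hij
      have h2 : d i / d j ≤ 1 := (div_le_one (hdpos j hj)).2 hij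
      have h3 : 0 ≤ d i / d j := div_nonneg (hdpos i hi).le (hdpos j hj).le
      have h4 : (1 - d i / d j) * (g j b - f b) ≤ |g j b - f b| := by
        have h5 := mul_le_mul_of_nonneg_left (le_abs_self (g j b - f b)) (sub_nonneg.2 h2)
        nlinarith [abs_nonneg (g j b - f b)]
      linarith)
  simpa only [sub_add_sub_cancel] using h

open Classical in
/-- The sum of the gaps over the whole explored set, against the information revealed
by a distribution `p` that plays the best arm half of the time and the explored arms with at least
half of their posterior probability. -/
theorem sq_sum_gap_le_information {K : ℕ} {ε : ℝ} (hε : 0 < ε) (hε1 : ε ≤ 1) {α f p : Fin K → ℝ}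
    {g : Fin K → Fin K → ℝ} {b : Fin K} (hα0 : ∀ i, 0 ≤ α i) (hα1 : ∑ i, α i = 1)
    (hf : ∀ i, f i ∈ Set.Icc (0 : ℝ) 1) (hfc : GridConvex f) (hgc : ∀ j, GridConvex (g j))
    (hb : ∀ i, f b ≤ f i) (S : Finset (Fin K)) (hS : ∀ i ∈ S, g i i ≤ f b ∧ ε / K ≤ α i)
    (hp0 : ∀ i, 0 ≤ p i) (hpS : ∀ i ∈ S, 1 / 2 * α i ≤ p i) (hpb : 1 / 2 ≤ p b) :
    (∑ j ∈ S, α j * (f j - g j j)) ^ 2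
      ≤ 45 * Real.log (2 * K / ε) * (∑ i, p i * ∑ j, α j * (g j i - f i) ^ 2 + ε ^ 2) := by
  have hK : (1 : ℝ) ≤ K := by exact_mod_cast b.pos
  have hK0 : (0 : ℝ) < K := by linarith
  set V := ∑ i, p i * ∑ j, α j * (g j i - f i) ^ 2 with hV
  let W : Fin K → ℝ := fun j => α j * ∑ i, p i * (g j i - f i) ^ 2
  have hW0 : ∀ j, 0 ≤ W j := fun j => mul_nonneg (hα0 j)
    (Finset.sum_nonneg fun i _ => mul_nonneg (hp0 i) (sq_nonneg _))
  have hVW : V = ∑ j, W j := by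
    simp only [hV, W, Finset.mul_sum]
    rw [Finset.sum_comm]
    exact Finset.sum_congr rfl fun j _ => Finset.sum_congr rfl fun i _ => by ring
  have hinfo : ∀ R ⊆ S, b ∉ R → ∀ j,
      α j * (∑ i ∈ R, α i * (f i - g j i) ^ 2 + |g j b - f b| ^ 2) ≤ 2 * W j := by
    intro R hRS hbR j
    have h1 : ∑ i ∈ insert b R, p i * (g j i - f i) ^ 2 ≤ ∑ i, p i * (g j i - f i) ^ 2 :=
      Finset.sum_le_univ_sum_of_nonneg fun i => mul_nonneg (hp0 i) (sq_nonneg _)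
    rw [Finset.sum_insert hbR] at h1
    have h2 : ∑ i ∈ R, α i * (f i - g j i) ^ 2 ≤ 2 * ∑ i ∈ R, p i * (g j i - f i) ^ 2 := by
      rw [Finset.mul_sum]
      refine Finset.sum_le_sum fun i hi => ?_
      have := mul_le_mul_of_nonneg_right (hpS i (hRS hi)) (sq_nonneg (g j i - f i))
      nlinarith
    have h3 := mul_le_mul_of_nonneg_right hpb (sq_nonneg (g j b - f b))
    rw [sq_abs]
    calc _ ≤ α j * (2 * ∑ i, p i * (g j i - f i) ^ 2) :=
          mul_le_mul_of_nonneg_left (by linarith) (hα0 j)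
      _ = 2 * W j := by simp only [W]; ring
  set M := 1 + Real.log (4 * (K / ε) ^ 3) with hM
  have hKε : 1 ≤ (K : ℝ) / ε := by rw [one_le_div hε]; linarith
  have hlog2 := Real.log_two_gt_d9
  have hL : Real.log (2 * K / ε) = Real.log 2 + Real.log (K / ε) := by
    rw [mul_div_assoc, Real.log_mul two_ne_zero (by positivity)]
  have hlogK : 0 ≤ Real.log (K / ε) := Real.log_nonneg hKε
  have hMeq : M = 1 + 2 * Real.log 2 + 3 * Real.log (K / ε) := by
    rw [hM, Real.log_mul (by norm_num) (by positivity), Real.log_pow,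
      show (4 : ℝ) = 2 ^ 2 by norm_num, Real.log_pow]
    push_cast; ring
  have hM0 : 0 ≤ M := by linarith
  have hside : ∀ R ⊆ S, ∀ σ : ℝ, (∀ i ∈ R, i ≠ b ∧
      σ * (gridPoint K i - gridPoint K b) = |gridPoint K i - gridPoint K b|) →
      (∑ j ∈ R, α j * (f j - g j j)) ^ 2 ≤ M * (3 * (2 * ∑ j ∈ R, W j + ε ^ 2)) := by
    intro R hRS σ hR
    refine (sq_sum_gap_le_of_sameSide hε hε1 hα0 hα1 hf hfc hgc hb R σ hR
      fun i hi => hS i (hRS hi)).trans ?_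
    have : ∑ j ∈ R, α j * (∑ i ∈ R, α i * (f i - g j i) ^ 2 + |g j b - f b| ^ 2)
        ≤ 2 * ∑ j ∈ R, W j := by
      rw [Finset.mul_sum]
      exact Finset.sum_le_sum fun j _ => hinfo R hRS (fun hbR => (hR b hbR).1 rfl) j
    gcongr
  have hlt : ∀ {i j : Fin K}, i < j → gridPoint K i < gridPoint K j := fun {i j} hij => by
    unfold gridPoint
    have : ((i : ℕ) : ℝ) < ((j : ℕ) : ℝ) := by exact_mod_cast hij
    gcongr
  have hright := hside {i ∈ S | b < i} (Finset.filter_subset _ _) 1 fun i hi => by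
    have h := (Finset.mem_filter.1 hi).2
    rw [one_mul, abs_of_pos (sub_pos.2 (hlt h))]
    exact ⟨h.ne', rfl⟩
  have hleft := hside {i ∈ {i ∈ S | ¬ b < i} | i < b}
    ((Finset.filter_subset _ _).trans (Finset.filter_subset _ _)) (-1) fun i hi => by
    have h := (Finset.mem_filter.1 hi).2
    rw [abs_of_neg (sub_neg.2 (hlt h)), neg_one_mul]
    exact ⟨h.ne, rfl⟩
  have hmid : (∑ j ∈ {i ∈ {i ∈ S | ¬ b < i} | ¬ i < b}, α j * (f j - g j j)) ^ 2
      ≤ 2 * ∑ j ∈ {i ∈ {i ∈ S | ¬ b < i} | ¬ i < b}, W j := by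
    have hsub : ({i ∈ {i ∈ S | ¬ b < i} | ¬ i < b} : Finset (Fin K)) ⊆ {b} := by
      intro i hi
      simp only [Finset.mem_filter, not_lt] at hi
      exact Finset.mem_singleton.2 (le_antisymm hi.1.2 hi.2)
    rcases Finset.subset_singleton_iff.1 hsub with h | h
    · rw [h]; simp
    · rw [h, Finset.sum_singleton, Finset.sum_singleton]
      have h1 := hinfo ∅ (Finset.empty_subset _) (Finset.notMem_empty _) b
      rw [Finset.sum_empty, zero_add, sq_abs] at h1
      have h2 : α b ≤ 1 := hα1 ▸ Finset.single_le_sum (fun i _ => hα0 i) (Finset.mem_univ b)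
      refine le_trans ?_ h1
      have h3 := mul_nonneg (hα0 b) (sq_nonneg (g b b - f b))
      nlinarith
  have hsplit : ∀ φ : Fin K → ℝ, ∑ j ∈ S, φ j = ∑ j ∈ {i ∈ S | b < i}, φ j
      + (∑ j ∈ {i ∈ {i ∈ S | ¬ b < i} | i < b}, φ j
        + ∑ j ∈ {i ∈ {i ∈ S | ¬ b < i} | ¬ i < b}, φ j) := fun φ => by
    rw [Finset.sum_filter_add_sum_filter_not, Finset.sum_filter_add_sum_filter_not]
  have hWV : ∑ j ∈ S, W j ≤ V := hVW ▸ Finset.sum_le_univ_sum_of_nonneg hW0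
  have hV0 : 0 ≤ V := hVW ▸ Finset.sum_nonneg fun j _ => hW0 j
  have hWr : 0 ≤ ∑ j ∈ {i ∈ S | b < i}, W j := Finset.sum_nonneg fun j _ => hW0 j
  have hWl : 0 ≤ ∑ j ∈ {i ∈ {i ∈ S | ¬ b < i} | i < b}, W j := Finset.sum_nonneg fun j _ => hW0 j
  have hWm : 0 ≤ ∑ j ∈ {i ∈ {i ∈ S | ¬ b < i} | ¬ i < b}, W j :=
    Finset.sum_nonneg fun j _ => hW0 j
  rw [hsplit] at hWV ⊢
  set x := ∑ j ∈ {i ∈ S | b < i}, α j * (f j - g j j)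
  set y := ∑ j ∈ {i ∈ {i ∈ S | ¬ b < i} | i < b}, α j * (f j - g j j)
  set z := ∑ j ∈ {i ∈ {i ∈ S | ¬ b < i} | ¬ i < b}, α j * (f j - g j j)
  set wx := ∑ j ∈ {i ∈ S | b < i}, W j
  set wy := ∑ j ∈ {i ∈ {i ∈ S | ¬ b < i} | i < b}, W j
  set wz := ∑ j ∈ {i ∈ {i ∈ S | ¬ b < i} | ¬ i < b}, W j
  -- The Cauchy-Schwarz inequality with the weights `6 * M` for the two sides and `1` for `b`.
  have hxy : (x + y) ^ 2 ≤ 6 * M * (2 * (wx + wy) + 2 * ε ^ 2) := by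
    nlinarith [sq_nonneg (x - y)]
  have hstep : (x + (y + z)) ^ 2 ≤ (6 * M + 1) * ((2 * (wx + wy) + 2 * ε ^ 2) + 2 * wz) := by
    have h := Finset.sum_sq_le_sum_mul_sum_of_sq_le_mul (Finset.univ : Finset (Fin 2))
      (r := ![x + y, z]) (f := ![6 * M, 1]) (g := ![2 * (wx + wy) + 2 * ε ^ 2, 2 * wz])
      (by simp [Fin.forall_fin_two, hM0])
      (fun i _ => by
        fin_cases i
        · change 0 ≤ 2 * (wx + wy) + 2 * ε ^ 2; positivity
        · change 0 ≤ 2 * wz; positivity)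
      (fun i _ => by
        fin_cases i
        · exact hxy
        · change z ^ 2 ≤ 1 * (2 * wz); rwa [one_mul])
    simpa [Fin.sum_univ_two, add_assoc] using h
  refine hstep.trans ?_
  have h1 : 2 * (wx + wy) + 2 * ε ^ 2 + 2 * wz ≤ 2 * (V + ε ^ 2) := by linarith
  -- As `log 2 > 0.69`, the constant terms of `6 * M + 1` fit into `45 / 2 * log 2`.
  have h2 : 6 * M + 1 ≤ 45 / 2 * Real.log (2 * K / ε) := by rw [hL, hMeq]; linarith
  calc _ ≤ (45 / 2 * Real.log (2 * K / ε)) * (2 * (V + ε ^ 2)) := by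
        refine mul_le_mul h2 h1 (by positivity) (by linarith)
    _ = _ := by ring

open Classical in
/-- One round of the algorithm, for given values of the posterior `α`, the mean loss `f` and the
conditional losses `g`. The parameter `η` balances the regret against the information. -/
theorem regret_le_information {K : ℕ} {ε : ℝ} (hε : 0 < ε) (hε1 : ε ≤ 1) {α f p : Fin K → ℝ}
    {g : Fin K → Fin K → ℝ} {b : Fin K} (hα0 : ∀ i, 0 ≤ α i) (hα1 : ∑ i, α i = 1)
    (hf : ∀ i, f i ∈ Set.Icc (0 : ℝ) 1) (hg : ∀ j i, g j i ∈ Set.Icc (0 : ℝ) 1)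
    (hfc : GridConvex f) (hgc : ∀ j, GridConvex (g j))
    (hb : ∀ i, f b ≤ f i) {S : Finset (Fin K)} (hS : ∀ i, i ∈ S ↔ g i i ≤ f b ∧ ε / K ≤ α i)
    (hp : ∀ i, p i = 1 / 2 * α i * (if i ∈ S then 1 else 0)
      + (1 - 1 / 2 * ∑ j ∈ S, α j) * (if i = b then 1 else 0)) {η : ℝ} (hη : 0 < η) :
    ∑ i, p i * f i - ∑ j, α j * g j j
      ≤ ε + √(45 * Real.log (2 * K / ε)) * ε + η / 2
        + 45 * Real.log (2 * K / ε) / (2 * η) * ∑ i, p i * ∑ j, α j * (g j i - f i) ^ 2 := by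
  have hK : (1 : ℝ) ≤ K := by exact_mod_cast b.pos
  have hαS : ∑ j ∈ S, α j ≤ 1 := hα1 ▸ Finset.sum_le_univ_sum_of_nonneg hα0
  have hp0 : ∀ i, 0 ≤ p i := fun i => by
    rw [hp]
    have := hα0 i
    refine add_nonneg (mul_nonneg (by positivity) (by split_ifs <;> norm_num))
      (mul_nonneg (by linarith) (by split_ifs <;> norm_num))
  have hpS : ∀ i ∈ S, 1 / 2 * α i ≤ p i := fun i hi => by
    rw [hp, if_pos hi, mul_one]
    exact le_add_of_nonneg_right (mul_nonneg (by linarith) (by split_ifs <;> norm_num))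
  have hpb : 1 / 2 ≤ p b := by
    rw [hp, if_pos rfl]
    have := mul_nonneg (mul_nonneg (by norm_num : (0 : ℝ) ≤ 1 / 2) (hα0 b))
      (by split_ifs <;> norm_num : (0 : ℝ) ≤ if b ∈ S then 1 else 0)
    linarith
  have hmain := sq_sum_gap_le_information hε hε1 hα0 hα1 hf hfc hgc hb S
    (fun i hi => (hS i).1 hi) hp0 hpS hpb
  set V := ∑ i, p i * ∑ j, α j * (g j i - f i) ^ 2
  have hV0 : 0 ≤ V := Finset.sum_nonneg fun i _ => mul_nonneg (hp0 i)
    (Finset.sum_nonneg fun j _ => mul_nonneg (hα0 j) (sq_nonneg _))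
  set c := 45 * Real.log (2 * K / ε)
  have hc : 0 ≤ c := mul_nonneg (by norm_num) (Real.log_nonneg (by
    rw [one_le_div hε]; linarith))
  -- The arms outside `S` lose at most `ε`: they gain nothing or have total probability at most `ε`.
  have hout : ∀ j, α j * (f b - g j j) ≤ (if j ∈ S then α j * (f b - g j j) else 0) + ε / K := by
    intro j
    have hεK : 0 ≤ ε / K := by positivity
    split_ifs with hj
    · linarith
    · rw [hS, not_and_or, not_le, not_le] at hj
      rcases hj with h | h
      · nlinarith [hα0 j]
      · nlinarith [hα0 j, (hf b).2, (hg j j).1]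
  have hsum := Finset.sum_le_sum fun j (_ : j ∈ Finset.univ) => hout j
  rw [Finset.sum_add_distrib, Finset.sum_const, Finset.card_univ, Fintype.card_fin, nsmul_eq_mul,
    mul_div_cancel₀ _ (by positivity : (K : ℝ) ≠ 0), Finset.sum_ite_mem, Finset.univ_inter] at hsum
  have hpf : ∑ i, p i * f i = 1 / 2 * ∑ j ∈ S, α j * f j + (1 - 1 / 2 * ∑ j ∈ S, α j) * f b := by
    simp only [hp, add_mul, Finset.sum_add_distrib]
    congr 1
    · simp only [mul_ite, mul_one, mul_zero, ite_mul, zero_mul, Finset.sum_ite_mem,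
        Finset.univ_inter, Finset.mul_sum, mul_assoc]
    · simp
  have hgap : ∑ i, p i * f i - ∑ j, α j * g j j ≤ ε + ∑ j ∈ S, α j * (f j - g j j) := by
    have h1 : ∑ j, α j * (f b - g j j) = f b - ∑ j, α j * g j j := by
      simp only [mul_sub, Finset.sum_sub_distrib]
      rw [← Finset.sum_mul, hα1, one_mul]
    have h2 : ∑ j ∈ S, α j * (f b - g j j) = (∑ j ∈ S, α j) * f b - ∑ j ∈ S, α j * g j j := by
      simp only [mul_sub, Finset.sum_sub_distrib]
      rw [← Finset.sum_mul]
    have h3 : ∑ j ∈ S, α j * (f j - g j j) = ∑ j ∈ S, α j * f j - ∑ j ∈ S, α j * g j j := by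
      simp only [mul_sub, Finset.sum_sub_distrib]
    have h4 : (∑ j ∈ S, α j) * f b ≤ ∑ j ∈ S, α j * f j := by
      rw [Finset.sum_mul]
      exact Finset.sum_le_sum fun j _ => mul_le_mul_of_nonneg_left (hb j) (hα0 j)
    rw [hpf, h3]
    linarith
  refine hgap.trans ?_
  have hsqrt : ∑ j ∈ S, α j * (f j - g j j) ≤ √c * ε + √(c * V) := by
    refine (le_abs_self _).trans (abs_le_of_sq_le_sq ?_ (by positivity))
    have h1 := Real.sq_sqrt hc
    have h2 := Real.sq_sqrt (mul_nonneg hc hV0)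
    have h3 : 0 ≤ √c * ε * √(c * V) := by positivity
    nlinarith
  have hamgm : √(c * V) ≤ η / 2 + c / (2 * η) * V := by
    have h2 := Real.sq_sqrt (mul_nonneg hc hV0)
    have h3 : η / 2 + c / (2 * η) * V - √(c * V) = (η - √(c * V)) ^ 2 / (2 * η) := by
      rw [sub_sq, h2]; field_simp; ring
    have : 0 ≤ (η - √(c * V)) ^ 2 / (2 * η) := by positivity
    linarith
  linarith

/-! ### Measurability and bounds of the losses -/

theorem measurable_eval {x : ℝ} (hx : x ∈ Set.Icc (0 : ℝ) 1) :
    Measurable fun f : ConvexLoss => f.toFun x :=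
  measurable_iff_comap_le.2 (le_iSup (fun y : Set.Icc (0 : ℝ) 1 =>
    MeasurableSpace.comap (fun f : ConvexLoss => f.toFun y) inferInstance) ⟨x, hx⟩)

theorem measurable_lossAt {T K : ℕ} (n : ℕ) (i : Fin K) :
    Measurable fun F : Fin T → ConvexLoss => lossAt F n (gridPoint K i) := by
  unfold lossAt
  split_ifs with h
  · exact (measurable_eval (gridPoint_mem_Icc i)).comp (measurable_pi_apply _)
  · exact measurable_const

theorem lossAt_mem_Icc {T K : ℕ} (F : Fin T → ConvexLoss) (n : ℕ) (i : Fin K) :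
    lossAt F n (gridPoint K i) ∈ Set.Icc (0 : ℝ) 1 := by
  unfold lossAt
  split_ifs with h
  · exact (F ⟨n, h⟩).mem_Icc _ (gridPoint_mem_Icc i)
  · simp

theorem measurable_hindsight {T K : ℕ} (opt : ArgminRule K) :
    Measurable (hindsight (T := T) opt) :=
  opt.measurable_sel.comp <| measurable_pi_lambda _ fun i => Finset.measurable_sum _ fun t _ =>
    (measurable_eval (gridPoint_mem_Icc i)).comp (measurable_pi_apply t)

theorem measurable_hindsightInd {T K n : ℕ} (opt : ArgminRule K) (i : Fin K) :
    Measurable (hindsightInd (T := T) (n := n) opt i) :=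
  Measurable.ite ((measurable_hindsight opt).comp measurable_fst (measurableSet_singleton i))
    measurable_const measurable_const

theorem hindsightInd_mem_Icc {T K n : ℕ} (opt : ArgminRule K) (i : Fin K) (s : State T K n) :
    hindsightInd opt i s ∈ Set.Icc (0 : ℝ) 1 := by
  unfold hindsightInd
  split_ifs <;> simp

theorem sum_hindsightInd {T K n : ℕ} (opt : ArgminRule K) (s : State T K n) :
    ∑ i, hindsightInd opt i s = 1 := by
  simp [hindsightInd]

theorem gridConvex_lossAt {T K : ℕ} (F : Fin T → ConvexLoss) (n : ℕ) :
    GridConvex fun i : Fin K => lossAt F n (gridPoint K i) := by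
  intro a b c hac h0 h1
  unfold lossAt
  split_ifs with h
  · have hne : gridPoint K c - gridPoint K a ≠ 0 := by
      have hK : (0 : ℝ) < K := by exact_mod_cast a.pos
      have h2 := one_div_le_abs_gridPoint_sub hac.symm
      exact abs_pos.1 ((by positivity : 0 < 1 / (K : ℝ)).trans_le h2)
    have hconv := (F ⟨n, h⟩).convexOn.2 (gridPoint_mem_Icc a) (gridPoint_mem_Icc c)
      (sub_nonneg.2 h1) h0 (sub_add_cancel _ _)
    have hpt : (1 - (gridPoint K b - gridPoint K a) / (gridPoint K c - gridPoint K a))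
        • gridPoint K a + ((gridPoint K b - gridPoint K a) / (gridPoint K c - gridPoint K a))
        • gridPoint K c = gridPoint K b := by
      simp only [smul_eq_mul]
      field_simp
      ring
    rw [hpt] at hconv
    exact hconv
  · simp

theorem historyAlg_le (T K n : ℕ) :
    historyAlg T K n ≤ (inferInstance : MeasurableSpace (State T K n)) :=
  measurable_snd.comap_le

theorem Measurable.of_historyAlg {T K n : ℕ} {g : State T K n → ℝ}
    (hg : Measurable[historyAlg T K n] g) : Measurable g :=
  hg.mono (historyAlg_le T K n) le_rfl

/-- A real function with values in the unit interval is essentially bounded. -/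
theorem memLp_top_of_mem_Icc {Ω : Type*} [MeasurableSpace Ω] {μ : Measure Ω} {g : Ω → ℝ}
    (hg : AEStronglyMeasurable g μ) (h : ∀ᵐ x ∂μ, g x ∈ Set.Icc (0 : ℝ) 1) : MemLp g ⊤ μ :=
  memLp_top_of_bound hg 1 <| h.mono fun x hx => by
    rw [Real.norm_eq_abs, abs_of_nonneg hx.1]; exact hx.2

/-- The product of two essentially bounded functions is essentially bounded. -/
theorem memLp_top_mul {Ω : Type*} [MeasurableSpace Ω] {μ : Measure Ω} {f g : Ω → ℝ}
    (hf : MemLp f ⊤ μ) (hg : MemLp g ⊤ μ) : MemLp (fun x => f x * g x) ⊤ μ :=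
  MemLp.mul' hg hf

theorem memLp_lossAt {T K n : ℕ} (P : Measure (State T K n)) (m : ℕ) (i : Fin K) :
    MemLp (fun s => lossAt s.1 m (gridPoint K i)) ⊤ P :=
  memLp_top_of_mem_Icc ((measurable_lossAt m i).comp measurable_fst).aestronglyMeasurable
    (ae_of_all _ fun s => lossAt_mem_Icc s.1 m i)

theorem memLp_hindsightInd {T K n : ℕ} (P : Measure (State T K n)) (opt : ArgminRule K)
    (i : Fin K) : MemLp (hindsightInd opt i) ⊤ P :=
  memLp_top_of_mem_Icc (measurable_hindsightInd opt i).aestronglyMeasurable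
    (ae_of_all _ fun s => hindsightInd_mem_Icc opt i s)

/-- Conditioning on the history does not change the integral against a function of the history. -/
theorem integral_mul_condExp_historyAlg {T K n : ℕ} {P : Measure (State T K n)}
    [IsProbabilityMeasure P] {g Y : State T K n → ℝ} (hg : Measurable[historyAlg T K n] g)
    (hgb : MemLp g ⊤ P) (hY : MemLp Y ⊤ P) :
    ∫ s, g s * (P[Y | historyAlg T K n]) s ∂P = ∫ s, g s * Y s ∂P := by
  have h := condExp_mul_of_stronglyMeasurable_left (m := historyAlg T K n) hg.stronglyMeasurable
    ((memLp_top_mul hgb hY).integrable le_top) (hY.integrable le_top)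
  exact (integral_congr_ae h.symm).trans (integral_condExp (historyAlg_le T K n))

/-! ### Appending one round to the history -/

/-- Round `n`, in which arm `i` is played, appended to the history. -/
def appendPlay {T K n : ℕ} (i : Fin K) (s : State T K n) : State T K (n + 1) :=
  (s.1, Fin.snoc s.2 (i, lossAt s.1 n (gridPoint K i)))

/-- The last round deleted from the history. -/
def dropLast {T K n : ℕ} (s : State T K (n + 1)) : State T K n :=
  (s.1, Fin.init s.2)

@[simp] theorem dropLast_appendPlay {T K n : ℕ} (i : Fin K) (s : State T K n) :
    dropLast (appendPlay i s) = s := by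
  simp only [dropLast, appendPlay, Fin.init_snoc]

@[simp] theorem appendPlay_last {T K n : ℕ} (i : Fin K) (s : State T K n) :
    (appendPlay i s).2 (Fin.last n) = (i, lossAt s.1 n (gridPoint K i)) := by
  simp only [appendPlay, Fin.snoc_last]

theorem measurable_appendPlay {T K n : ℕ} (i : Fin K) :
    Measurable (appendPlay (T := T) (n := n) i) := by
  refine measurable_fst.prodMk (measurable_pi_lambda _ fun t => ?_)
  refine Fin.lastCases ?_ (fun t => ?_) t
  · simp only [Fin.snoc_last]
    exact measurable_const.prodMk ((measurable_lossAt n i).comp measurable_fst)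
  · simp only [Fin.snoc_castSucc]
    exact (measurable_pi_apply t).comp measurable_snd

theorem measurable_init {K n : ℕ} :
    Measurable (Fin.init : History K (n + 1) → History K n) :=
  measurable_pi_lambda _ fun t => measurable_pi_apply t.castSucc

theorem measurable_dropLast {T K n : ℕ} : Measurable (dropLast (T := T) (K := K) (n := n)) :=
  measurable_fst.prodMk (measurable_init.comp measurable_snd)

/-- A function of the former history and of the arm played last is a function of the history. -/
theorem measurable_lastArm {T K n : ℕ} {φ : Fin K → State T K n → ℝ}
    (hφ : ∀ i, Measurable[historyAlg T K n] (φ i)) :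
    Measurable[historyAlg T K (n + 1)] fun s : State T K (n + 1) =>
      φ (s.2 (Fin.last n)).1 (dropLast s) := by
  choose ψ hψ hφψ using fun i => (hφ i).exists_eq_measurable_comp
  have h1 : Measurable fun x : Fin K × History K n => ψ x.1 x.2 :=
    measurable_from_prod_countable_right fun i => hψ i
  have h2 : Measurable fun h : History K (n + 1) => ψ (h (Fin.last n)).1 (Fin.init h) :=
    h1.comp ((measurable_fst.comp (measurable_pi_apply (Fin.last n))).prodMk measurable_init)
  have h3 : (fun s : State T K (n + 1) => φ (s.2 (Fin.last n)).1 (dropLast s))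
      = (fun h : History K (n + 1) => ψ (h (Fin.last n)).1 (Fin.init h)) ∘ Prod.snd := by
    funext s
    rw [hφψ]; rfl
  rw [h3]
  exact h2.comp (comap_measurable _)

/-- The law of the state after one more round, in which arm `i` is played with probability `p i`. -/
def playStep {T K n : ℕ} (P : Measure (State T K n)) (p : Fin K → State T K n → ℝ) :
    Measure (State T K (n + 1)) :=
  ∑ i : Fin K, (P.withDensity fun s => ENNReal.ofReal (p i s)).map (appendPlay i)

/-- The functions `p i` are the probabilities of playing the arms, given the history. -/
structure IsStrategy {T K n : ℕ} (P : Measure (State T K n)) (p : Fin K → State T K n → ℝ) :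
    Prop where
  measurable : ∀ i, Measurable[historyAlg T K n] (p i)
  nonneg : ∀ᵐ s ∂P, ∀ i, 0 ≤ p i s
  sum_eq_one : ∀ s, ∑ i, p i s = 1

namespace IsStrategy

variable {T K n : ℕ} {P : Measure (State T K n)} {p : Fin K → State T K n → ℝ}

theorem memLp (hp : IsStrategy P p) (i : Fin K) : MemLp (p i) ⊤ P :=
  memLp_top_of_mem_Icc (Measurable.of_historyAlg (hp.measurable i)).aestronglyMeasurable <|
    hp.nonneg.mono fun s hs => ⟨hs i, hp.sum_eq_one s ▸
      Finset.single_le_sum (f := fun i => p i s) (fun j _ => hs j) (Finset.mem_univ i)⟩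

/-- Playing a round and forgetting it changes nothing. -/
theorem measurePreserving_dropLast (hp : IsStrategy P p) :
    MeasurePreserving dropLast (playStep P p) P := by
  refine ⟨measurable_dropLast, Measure.ext fun A hA => ?_⟩
  rw [Measure.map_apply measurable_dropLast hA, playStep, Measure.finsetSum_apply]
  have h1 : ∀ i : Fin K, (P.withDensity fun s => ENNReal.ofReal (p i s)).map (appendPlay i)
      (dropLast ⁻¹' A) = ∫⁻ s in A, ENNReal.ofReal (p i s) ∂P := fun i => by
    have h2 : appendPlay i ⁻¹' (dropLast ⁻¹' A) = A := by ext s; simp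
    rw [Measure.map_apply (measurable_appendPlay i) (measurable_dropLast hA), h2,
      withDensity_apply _ hA]
  rw [Finset.sum_congr rfl fun i _ => h1 i, ← lintegral_finsetSum _ fun i _ =>
    (Measurable.of_historyAlg (hp.measurable i)).ennreal_ofReal]
  have h3 : ∫⁻ s in A, ∑ i, ENNReal.ofReal (p i s) ∂P = ∫⁻ _ in A, 1 ∂P := by
    refine lintegral_congr_ae (ae_restrict_of_ae (hp.nonneg.mono fun s hs => ?_))
    simp only
    rw [← ENNReal.ofReal_sum_of_nonneg fun i _ => hs i, hp.sum_eq_one, ENNReal.ofReal_one]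
  rw [h3, setLIntegral_one]

theorem isProbabilityMeasure [IsProbabilityMeasure P] (hp : IsStrategy P p) :
    IsProbabilityMeasure (playStep P p) :=
  have h : IsProbabilityMeasure ((playStep P p).map dropLast) := by
    rw [hp.measurePreserving_dropLast.map_eq]; infer_instance
  Measure.isProbabilityMeasure_of_map dropLast

/-- Integrals after the round: average over the arm that is played. -/
theorem integral_playStep (hp : IsStrategy P p)
    {G : State T K (n + 1) → ℝ} (hG : Integrable G (playStep P p)) :
    ∫ s, G s ∂(playStep P p) = ∑ i, ∫ s, p i s * G (appendPlay i s) ∂P := by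
  have hG' := integrable_finsetSum_measure.1 hG
  rw [playStep, integral_finsetSum_measure hG']
  refine Finset.sum_congr rfl fun i hi => ?_
  rw [integral_map (measurable_appendPlay i).aemeasurable (hG' i hi).aestronglyMeasurable,
    integral_withDensity_eq_integral_toReal_smul
      (Measurable.of_historyAlg (hp.measurable i)).ennreal_ofReal
      (ae_of_all _ fun _ => ENNReal.ofReal_lt_top)]
  refine integral_congr_ae (hp.nonneg.mono fun s hs => ?_)
  simp only [ENNReal.toReal_ofReal (hs i), smul_eq_mul]

theorem integral_dropLast (hp : IsStrategy P p) {g : State T K n → ℝ}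
    (hg : AEStronglyMeasurable g P) :
    ∫ s, g (dropLast s) ∂(playStep P p) = ∫ s, g s ∂P := by
  have h := hp.measurePreserving_dropLast
  conv_rhs => rw [← h.map_eq]
  rw [integral_map measurable_dropLast.aemeasurable (h.map_eq.symm ▸ hg)]

theorem memLp_dropLast (hp : IsStrategy P p) {g : State T K n → ℝ} (hg : MemLp g ⊤ P) :
    MemLp (fun s => g (dropLast s)) ⊤ (playStep P p) :=
  hg.comp_measurePreserving hp.measurePreserving_dropLast

theorem ae_dropLast (hp : IsStrategy P p) {q : State T K n → Prop} (hq : ∀ᵐ s ∂P, q s) :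
    ∀ᵐ s ∂(playStep P p), q (dropLast s) :=
  hp.measurePreserving_dropLast.quasiMeasurePreserving.ae hq

theorem memLp_lastArm (hp : IsStrategy P p) {φ : Fin K → State T K n → ℝ}
    (hφ : ∀ i, Measurable[historyAlg T K n] (φ i)) {C : ℝ} (hC : ∀ᵐ s ∂P, ∀ i, |φ i s| ≤ C) :
    MemLp (fun s : State T K (n + 1) => φ (s.2 (Fin.last n)).1 (dropLast s)) ⊤ (playStep P p) :=
  memLp_top_of_bound (Measurable.of_historyAlg (measurable_lastArm hφ)).aestronglyMeasurable C
    ((hp.ae_dropLast hC).mono fun _ hs => hs _)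

end IsStrategy

/-! ### Posterior probabilities and conditional losses -/

section Posterior

variable {T K n : ℕ} {P : Measure (State T K n)} [IsProbabilityMeasure P]

theorem condExp_mem_Icc {Y : State T K n → ℝ} (hY : MemLp Y ⊤ P)
    (h : ∀ s, Y s ∈ Set.Icc (0 : ℝ) 1) :
    ∀ᵐ s ∂P, (P[Y | historyAlg T K n]) s ∈ Set.Icc (0 : ℝ) 1 := by
  have h0 := condExp_nonneg (μ := P) (m := historyAlg T K n) (ae_of_all _ fun s => (h s).1)
  have h1 := condExp_mono (μ := P) (m := historyAlg T K n) (hY.integrable le_top)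
    (integrable_const (1 : ℝ)) (ae_of_all _ fun s => (h s).2)
  rw [condExp_const (historyAlg_le T K n)] at h1
  filter_upwards [h0, h1] with s h0 h1 using ⟨h0, h1⟩

theorem gridConvex_condExp {Y : Fin K → State T K n → ℝ} (hY : ∀ i, MemLp (Y i) ⊤ P)
    (h : ∀ s, GridConvex fun i => Y i s) :
    ∀ᵐ s ∂P, GridConvex fun i => (P[Y i | historyAlg T K n]) s := by
  simp only [GridConvex, ae_all_iff]
  intro a b c hac h0 h1
  set t := (gridPoint K b - gridPoint K a) / (gridPoint K c - gridPoint K a) with ht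
  have hYi : ∀ i, Integrable (Y i) P := fun i => (hY i).integrable le_top
  have hmono := condExp_mono (μ := P) (m := historyAlg T K n) (hYi b)
    (((hYi a).smul (1 - t)).add ((hYi c).smul t)) (ae_of_all _ fun s => h s a b c hac h0 h1)
  have hadd := condExp_add ((hYi a).smul (1 - t)) ((hYi c).smul t) (historyAlg T K n)
  have ha := condExp_smul (μ := P) (1 - t) (Y a) (historyAlg T K n)
  have hc := condExp_smul (μ := P) t (Y c) (historyAlg T K n)
  filter_upwards [hmono, hadd, ha, hc] with s hmono hadd ha hc
  rw [hadd, Pi.add_apply, ha, hc] at hmono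
  exact hmono

theorem measurable_posterior (P : Measure (State T K n)) (opt : ArgminRule K) (i : Fin K) :
    Measurable[historyAlg T K n] (posterior P opt i) :=
  stronglyMeasurable_condExp.measurable

theorem measurable_meanLoss (P : Measure (State T K n)) (i : Fin K) :
    Measurable[historyAlg T K n] (meanLoss P i) :=
  stronglyMeasurable_condExp.measurable

theorem measurable_meanLossGiven (P : Measure (State T K n)) (opt : ArgminRule K) (j i : Fin K) :
    Measurable[historyAlg T K n] (meanLossGiven P opt j i) :=
  Measurable.div stronglyMeasurable_condExp.measurable (measurable_posterior P opt j)

theorem posterior_mem_Icc (opt : ArgminRule K) :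
    ∀ᵐ s ∂P, ∀ i, posterior P opt i s ∈ Set.Icc (0 : ℝ) 1 :=
  ae_all_iff.2 fun i => condExp_mem_Icc (memLp_hindsightInd P opt i) (hindsightInd_mem_Icc opt i)

theorem memLp_posterior (P : Measure (State T K n)) (opt : ArgminRule K) (i : Fin K) :
    MemLp (posterior P opt i) ⊤ P :=
  (memLp_hindsightInd P opt i).condExp le_top

theorem sum_posterior (opt : ArgminRule K) : ∀ᵐ s ∂P, ∑ i, posterior P opt i s = 1 := by
  have h := condExp_finsetSum (μ := P) (s := Finset.univ) (f := hindsightInd opt)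
    (fun i _ => (memLp_hindsightInd P opt i).integrable le_top) (historyAlg T K n)
  have h1 : ∑ i, hindsightInd (T := T) (n := n) opt i = fun _ => (1 : ℝ) := by
    funext s
    rw [Finset.sum_apply, sum_hindsightInd]
  rw [h1, condExp_const (historyAlg_le T K n)] at h
  filter_upwards [h] with s hs
  rw [hs, Finset.sum_apply]
  rfl

theorem meanLoss_mem_Icc : ∀ᵐ s ∂P, ∀ i, meanLoss P i s ∈ Set.Icc (0 : ℝ) 1 :=
  ae_all_iff.2 fun i => condExp_mem_Icc (memLp_lossAt P n i) fun s => lossAt_mem_Icc s.1 n i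

theorem gridConvex_meanLoss : ∀ᵐ s ∂P, GridConvex fun i => meanLoss P i s :=
  gridConvex_condExp (fun i => memLp_lossAt P n i) fun s => gridConvex_lossAt s.1 n

theorem memLp_lossAt_mul_hindsightInd (P : Measure (State T K n)) (opt : ArgminRule K)
    (j i : Fin K) :
    MemLp (fun s => lossAt s.1 n (gridPoint K i) * hindsightInd opt j s) ⊤ P :=
  memLp_top_mul (memLp_lossAt P n i) (memLp_hindsightInd P opt j)

theorem jointLoss_mem_Icc (opt : ArgminRule K) : ∀ᵐ s ∂P, ∀ j i,
    (P[fun s => lossAt s.1 n (gridPoint K i) * hindsightInd opt j s | historyAlg T K n]) s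
      ∈ Set.Icc 0 (posterior P opt j s) := by
  refine ae_all_iff.2 fun j => ae_all_iff.2 fun i => ?_
  have h0 := condExp_nonneg (μ := P) (m := historyAlg T K n) (ae_of_all _ fun s =>
    mul_nonneg (lossAt_mem_Icc s.1 n i).1 (hindsightInd_mem_Icc opt j s).1)
  have h1 := condExp_mono (μ := P) (m := historyAlg T K n)
    ((memLp_lossAt_mul_hindsightInd P opt j i).integrable le_top)
    ((memLp_hindsightInd P opt j).integrable le_top) (ae_of_all _ fun s =>
      mul_le_of_le_one_left (hindsightInd_mem_Icc opt j s).1 (lossAt_mem_Icc s.1 n i).2)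
  filter_upwards [h0, h1] with s h0 h1 using ⟨h0, h1⟩

/-- Where `posterior j` vanishes, so does the conditional expectation in the numerator of
`meanLossGiven j i`, and the identity holds with the value `0 / 0 = 0`. -/
theorem posterior_mul_meanLossGiven (opt : ArgminRule K) : ∀ᵐ s ∂P, ∀ j i,
    posterior P opt j s * meanLossGiven P opt j i s
      = (P[fun s => lossAt s.1 n (gridPoint K i) * hindsightInd opt j s | historyAlg T K n]) s := by
  filter_upwards [jointLoss_mem_Icc (P := P) opt] with s hs j i
  unfold meanLossGiven
  by_cases h : posterior P opt j s = 0
  · have := hs j i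
    rw [h, Set.Icc_self, Set.mem_singleton_iff] at this
    rw [h, this, zero_mul]
  · exact mul_div_cancel₀ _ h

theorem meanLossGiven_mem_Icc (opt : ArgminRule K) :
    ∀ᵐ s ∂P, ∀ j i, meanLossGiven P opt j i s ∈ Set.Icc (0 : ℝ) 1 := by
  filter_upwards [jointLoss_mem_Icc (P := P) opt] with s hs j i
  have h := hs j i
  exact ⟨div_nonneg h.1 (h.1.trans h.2), div_le_one_of_le₀ h.2 (h.1.trans h.2)⟩

theorem abs_meanLossGiven_sub_meanLoss_le (opt : ArgminRule K) :
    ∀ᵐ s ∂P, ∀ j i, |meanLossGiven P opt j i s - meanLoss P i s| ≤ 1 := by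
  filter_upwards [meanLossGiven_mem_Icc (P := P) opt, meanLoss_mem_Icc (P := P)] with s h1 h2 j i
  exact abs_le.2 ⟨by linarith [(h1 j i).1, (h2 i).2], by linarith [(h1 j i).2, (h2 i).1]⟩

theorem memLp_meanLossGiven_sub_meanLoss (P : Measure (State T K n)) [IsProbabilityMeasure P]
    (opt : ArgminRule K) (j i : Fin K) :
    MemLp (fun s => meanLossGiven P opt j i s - meanLoss P i s) ⊤ P :=
  memLp_top_of_bound (Measurable.of_historyAlg (Measurable.sub
      (measurable_meanLossGiven P opt j i) (measurable_meanLoss P i))).aestronglyMeasurable 1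
    ((abs_meanLossGiven_sub_meanLoss_le opt).mono fun _ hs => hs j i)

theorem gridConvex_meanLossGiven (opt : ArgminRule K) :
    ∀ᵐ s ∂P, ∀ j, GridConvex fun i => meanLossGiven P opt j i s := by
  refine ae_all_iff.2 fun j => ?_
  have h := gridConvex_condExp (P := P) (memLp_lossAt_mul_hindsightInd P opt j)
    fun s a b c hac h0 h1 => by
    have := mul_le_mul_of_nonneg_right (gridConvex_lossAt s.1 n a b c hac h0 h1)
      (hindsightInd_mem_Icc opt j s).1
    linarith
  filter_upwards [h, posterior_mem_Icc (P := P) opt] with s hs hα a b c hac h0 h1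
  have := div_le_div_of_nonneg_right (hs a b c hac h0 h1) (hα j).1
  rw [add_div, mul_div_assoc, mul_div_assoc] at this
  exact this

/-! ### The probabilities with which the algorithm plays -/

theorem measurable_bestArm (P : Measure (State T K n)) (best : ArgminRule K) :
    Measurable[historyAlg T K n] (bestArm P best) :=
  best.measurable_sel.comp (@measurable_pi_lambda _ _ _ (historyAlg T K n) _ _
    fun i => measurable_meanLoss P i)

theorem isStrategy_playProb (ε : ℝ) (opt best : ArgminRule K) :
    IsStrategy P (playProb P ε opt best) where
  measurable i := by
    have hbest : Measurable[historyAlg T K n] fun s => meanLoss P (bestArm P best s) s := by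
      have h : (fun s => meanLoss P (bestArm P best s) s)
          = fun s => ∑ i, if bestArm P best s = i then meanLoss P i s else 0 := by
        funext s; simp
      rw [h]
      exact Finset.measurable_sum _ fun i _ => Measurable.ite
        (measurable_bestArm P best (measurableSet_singleton i)) (measurable_meanLoss P i)
        measurable_const
    have hS : ∀ i, MeasurableSet[historyAlg T K n] {s | i ∈ exploreSet P ε opt best s} :=
        fun i => by
      simp only [exploreSet, Finset.mem_filter, Finset.mem_univ, true_and]
      exact (measurableSet_le (measurable_meanLossGiven P opt i i) hbest).inter
        (measurableSet_le measurable_const (measurable_posterior P opt i))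
    have hsum : Measurable[historyAlg T K n]
        fun s => ∑ j ∈ exploreSet P ε opt best s, posterior P opt j s := by
      classical
      have h : (fun s => ∑ j ∈ exploreSet P ε opt best s, posterior P opt j s)
          = fun s => ∑ j, if j ∈ exploreSet P ε opt best s then posterior P opt j s else 0 := by
        funext s; rw [Finset.sum_ite_mem, Finset.univ_inter]
      rw [h]
      exact Finset.measurable_sum _ fun j _ => Measurable.ite (hS j) (measurable_posterior P opt j)
        measurable_const
    refine Measurable.add (Measurable.mul (Measurable.mul measurable_const
      (measurable_posterior P opt i)) (Measurable.ite (hS i) measurable_const measurable_const))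
      (Measurable.mul (Measurable.sub measurable_const (Measurable.mul measurable_const hsum))
      (Measurable.ite ?_ measurable_const measurable_const))
    have := measurable_bestArm P best (measurableSet_singleton i)
    convert this using 1
    ext s
    simp [eq_comm]
  nonneg := by
    filter_upwards [posterior_mem_Icc (P := P) opt, sum_posterior (P := P) opt] with s hα h1 i
    have hS : ∑ j ∈ exploreSet P ε opt best s, posterior P opt j s ≤ 1 :=
      h1 ▸ Finset.sum_le_univ_sum_of_nonneg fun j => (hα j).1
    refine add_nonneg (mul_nonneg (mul_nonneg (by norm_num) (hα i).1) ?_)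
      (mul_nonneg (by linarith) ?_) <;> split_ifs <;> norm_num
  sum_eq_one s := by
    classical
    simp only [playProb, Finset.sum_add_distrib]
    simp only [mul_ite, mul_one, mul_zero, Finset.sum_ite_mem, Finset.univ_inter,
      Finset.sum_ite_eq', Finset.mem_univ, if_true, ← Finset.mul_sum]
    ring

end Posterior

/-! ### Information and the entropy of the posterior -/

/-- A Hellinger form of Pinsker's inequality for a single term of a relative entropy. -/
theorem sq_sqrt_sub_sqrt_le {x y : ℝ} (hx : 0 ≤ x) (hy : 0 < y) :
    (√x - √y) ^ 2 ≤ -Real.negMulLog x - x * Real.log y - x + y := by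
  have hsx := Real.sq_sqrt hx
  have hsy := Real.sq_sqrt hy.le
  rcases hx.eq_or_lt with rfl | hx
  · simp [hsy]
  · have h := Real.log_le_sub_one_of_pos (show 0 < √y / √x by positivity)
    rw [Real.log_div (by positivity) (by positivity), Real.log_sqrt hx.le, Real.log_sqrt hy.le] at h
    have h1 := mul_le_mul_of_nonneg_left h hx.le
    have h2 : x * (√y / √x - 1) = √x * √y - x := by
      rw [mul_sub, mul_one, ← mul_div_assoc, sub_left_inj, div_eq_iff (by positivity : √x ≠ 0)]
      linear_combination -√y * hsx
    rw [h2] at h1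
    unfold Real.negMulLog
    nlinarith

/-- The change of the posterior probability of an arm, from `a` to `a'`, against the observed
loss `y`, is controlled by the relative entropy. The prior value is shifted by `δ` to keep the
logarithm bounded. -/
theorem deviation_mul_le {a a' D y δ : ℝ} (ha : 0 ≤ a) (ha' : 0 ≤ a') (hD : |D| ≤ 1)
    (hy : y ∈ Set.Icc (0 : ℝ) 1) (hδ : 0 < δ) :
    D * (y - 1 / 2) * (a' - a)
      ≤ 1 / 2 * (-Real.negMulLog a' - a' * Real.log (a + δ) - a' + a)
        + 1 / 4 * (D ^ 2 * a' + D ^ 2 * a) + 5 / 4 * δ := by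
  have hH := sq_sqrt_sub_sqrt_le ha' (by linarith : 0 < a + δ)
  have h1 := Real.sq_sqrt ha'
  have h2 := Real.sq_sqrt (by linarith : 0 ≤ a + δ)
  set u := √a'
  set v := √(a + δ)
  have hD2 : D ^ 2 ≤ 1 := by rw [← sq_abs]; nlinarith [abs_nonneg D]
  have hw : |D * (y - 1 / 2)| ≤ 1 / 2 * |D| := by
    rw [abs_mul, mul_comm]
    exact mul_le_mul_of_nonneg_right (abs_le.2 ⟨by linarith [hy.1], by linarith [hy.2]⟩)
      (abs_nonneg D)
  have hw1 : |D * (y - 1 / 2)| ≤ 1 / 2 := by linarith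
  have hw2 : (D * (y - 1 / 2)) ^ 2 ≤ 1 / 4 * D ^ 2 := by
    rw [← sq_abs, ← sq_abs D]
    nlinarith [abs_nonneg (D * (y - 1 / 2))]
  set w := D * (y - 1 / 2)
  have h3 : a' - a = (u - v) * (u + v) + δ := by nlinarith
  have h4 : w * δ ≤ 1 / 2 * δ := mul_le_mul_of_nonneg_right ((le_abs_self w).trans hw1) hδ.le
  have h5 : w * ((u - v) * (u + v)) ≤ 1 / 2 * (u - v) ^ 2 + 1 / 2 * (w ^ 2 * (u + v) ^ 2) := by
    nlinarith [sq_nonneg ((u - v) - w * (u + v))]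
  have h6 : w ^ 2 * (u + v) ^ 2 ≤ 1 / 4 * D ^ 2 * (2 * (a' + (a + δ))) :=
    mul_le_mul hw2 (by nlinarith [sq_nonneg (u - v)]) (sq_nonneg _) (by positivity)
  have h7 : D ^ 2 * δ ≤ δ := mul_le_of_le_one_left hδ.le hD2
  rw [h3, mul_add]
  nlinarith

variable {T K n : ℕ}

/-- The expected entropy of the posterior distribution of the best arm in hindsight. -/
def posteriorEntropy (P : Measure (State T K n)) (opt : ArgminRule K) : ℝ :=
  ∫ s, ∑ j, Real.negMulLog (posterior P opt j s) ∂P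

/-- The variance, given the history, of the conditional mean of the coming loss given `X⋆`, averaged
over the arm played, which is drawn with the probabilities `p`. -/
def roundInfo (P : Measure (State T K n)) (p : Fin K → State T K n → ℝ) (opt : ArgminRule K)
    (s : State T K n) : ℝ :=
  ∑ i, p i s * ∑ j, posterior P opt j s * (meanLossGiven P opt j i s - meanLoss P i s) ^ 2

theorem negMulLog_mem_Icc {x : ℝ} (hx : x ∈ Set.Icc (0 : ℝ) 1) :
    Real.negMulLog x ∈ Set.Icc (0 : ℝ) 1 := by
  refine ⟨Real.negMulLog_nonneg hx.1 hx.2, ?_⟩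
  have := Real.negMulLog_le_one_sub_self hx.1
  linarith [hx.1]

theorem memLp_negMulLog_posterior (P : Measure (State T K n)) [IsProbabilityMeasure P]
    (opt : ArgminRule K) (j : Fin K) :
    MemLp (fun s => Real.negMulLog (posterior P opt j s)) ⊤ P :=
  memLp_top_of_mem_Icc (Real.continuous_negMulLog.measurable.comp
      (Measurable.of_historyAlg (measurable_posterior P opt j))).aestronglyMeasurable <|
    (posterior_mem_Icc opt).mono fun _ hs => negMulLog_mem_Icc (hs j)

section Round

variable {P : Measure (State T K n)} [IsProbabilityMeasure P] {p : Fin K → State T K n → ℝ}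

/-- Given the former history and the arm played, the new posterior has the old one as its mean. -/
theorem IsStrategy.integral_mul_posterior (hp : IsStrategy P p) (opt : ArgminRule K) (j : Fin K)
    {φ : Fin K → State T K n → ℝ} (hφ : ∀ i, Measurable[historyAlg T K n] (φ i)) {C : ℝ}
    (hC : ∀ᵐ s ∂P, ∀ i, |φ i s| ≤ C) :
    ∫ s, φ (s.2 (Fin.last n)).1 (dropLast s) * posterior (playStep P p) opt j s ∂(playStep P p)
      = ∫ s, φ (s.2 (Fin.last n)).1 (dropLast s) * posterior P opt j (dropLast s)
          ∂(playStep P p) := by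
  have := hp.isProbabilityMeasure
  have hφm := hp.memLp_lastArm hφ hC
  have hφi : ∀ i, MemLp (φ i) ⊤ P := fun i =>
    memLp_top_of_bound (Measurable.of_historyAlg (hφ i)).aestronglyMeasurable C
      (hC.mono fun s hs => hs i)
  rw [posterior, integral_mul_condExp_historyAlg (measurable_lastArm hφ) hφm
    (memLp_hindsightInd _ opt j), hp.integral_playStep ((memLp_top_mul hφm
    (memLp_hindsightInd _ opt j)).integrable le_top), hp.integral_playStep ((memLp_top_mul hφm
    (hp.memLp_dropLast (memLp_posterior P opt j))).integrable le_top)]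
  refine Finset.sum_congr rfl fun i _ => ?_
  simp only [appendPlay_last, dropLast_appendPlay, ← mul_assoc]
  exact (integral_mul_condExp_historyAlg (Measurable.mul (hp.measurable i) (hφ i))
    (memLp_top_mul (hp.memLp i) (hφi i)) (memLp_hindsightInd P opt j)).symm

/-- The information about the event that `X⋆` is arm `j` is at most what the round takes from the
`j`-th term of the entropy of the posterior. -/
theorem IsStrategy.integral_info_le (hp : IsStrategy P p) (opt : ArgminRule K) (j : Fin K) :
    ∑ i, ∫ s, p i s * (posterior P opt j s * (meanLossGiven P opt j i s - meanLoss P i s) ^ 2) ∂P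
      ≤ ∫ s, Real.negMulLog (posterior P opt j s) ∂P
        - ∫ s, Real.negMulLog (posterior (playStep P p) opt j s) ∂(playStep P p) := by
  have hQ := hp.isProbabilityMeasure
  set Q := playStep P p
  set a : State T K n → ℝ := posterior P opt j
  let d : Fin K → State T K n → ℝ := fun i s => meanLossGiven P opt j i s - meanLoss P i s
  let D : State T K (n + 1) → ℝ := fun s => d (s.2 (Fin.last n)).1 (dropLast s)
  let A : State T K (n + 1) → ℝ := fun s => a (dropLast s)
  set A' : State T K (n + 1) → ℝ := posterior Q opt j
  -- The observed loss, clipped to the unit interval, in which it almost surely lies.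
  let y : State T K (n + 1) → ℝ := fun s => max 0 (min 1 (s.2 (Fin.last n)).2)
  have hy : ∀ s, y s ∈ Set.Icc (0 : ℝ) 1 := fun s =>
    ⟨le_max_left _ _, max_le zero_le_one (min_le_left _ _)⟩
  have hyapp : ∀ i s, y (appendPlay i s) = lossAt s.1 n (gridPoint K i) := fun i s => by
    have h := lossAt_mem_Icc s.1 n i
    simp only [y, appendPlay_last]
    rw [min_eq_right h.2, max_eq_right h.1]
  have hym : Measurable[historyAlg T K (n + 1)] y := by
    have h : Measurable fun h : History K (n + 1) => max (0 : ℝ) (min 1 (h (Fin.last n)).2) :=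
      measurable_const.max (measurable_const.min (measurable_snd.comp (measurable_pi_apply _)))
    exact h.comp (comap_measurable _)
  have hdm : ∀ i, Measurable[historyAlg T K n] (d i) := fun i =>
    Measurable.sub (measurable_meanLossGiven P opt j i) (measurable_meanLoss P i)
  have hdb : ∀ᵐ s ∂P, ∀ i, |d i s| ≤ 1 :=
    (abs_meanLossGiven_sub_meanLoss_le opt).mono fun s hs => hs j
  have hdP : ∀ i, MemLp (d i) ⊤ P := memLp_meanLossGiven_sub_meanLoss P opt j
  have hDm : Measurable[historyAlg T K (n + 1)] D := measurable_lastArm hdm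
  have hD : MemLp D ⊤ Q := hp.memLp_lastArm hdm hdb
  have hA : MemLp A ⊤ Q := hp.memLp_dropLast (memLp_posterior P opt j)
  have hA' : MemLp A' ⊤ Q := memLp_posterior Q opt j
  have hyQ : MemLp y ⊤ Q :=
    memLp_top_of_mem_Icc (Measurable.of_historyAlg hym).aestronglyMeasurable (ae_of_all _ hy)
  have hone : ∀ m' : ℕ, ∀ R : Measure (State T K m'), MemLp (hindsightInd opt j) ⊤ R := fun _ R =>
    memLp_hindsightInd R opt j
  have hw : MemLp (fun s => D s * (y s - 1 / 2)) ⊤ Q :=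
    memLp_top_mul hD (hyQ.sub (memLp_top_const _))
  have hwm : Measurable[historyAlg T K (n + 1)] fun s => D s * (y s - 1 / 2) :=
    Measurable.mul hDm (Measurable.sub hym measurable_const)
  have hD2 : MemLp (fun s => D s ^ 2) ⊤ Q := by
    simpa only [sq] using memLp_top_mul hD hD
  set X := ∑ i, ∫ s, p i s * (a s * (meanLossGiven P opt j i s - meanLoss P i s) ^ 2) ∂P
  -- The three occurrences of `X`: against the old posterior, against the new one, and as the
  -- covariance of the observed loss with the change of the posterior.
  have hX : ∫ s, D s ^ 2 * A s ∂Q = X := by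
    rw [hp.integral_playStep ((memLp_top_mul hD2 hA).integrable le_top)]
    refine Finset.sum_congr rfl fun i _ => integral_congr_ae (ae_of_all _ fun s => ?_)
    simp only [D, A, d, appendPlay_last, dropLast_appendPlay]
    ring
  have hX' : ∫ s, D s ^ 2 * A' s ∂Q = X := by
    rw [← hX]
    refine hp.integral_mul_posterior opt j (φ := fun i s => d i s ^ 2) (C := 1)
      (fun i => Measurable.pow_const (hdm i) 2) (hdb.mono fun s hs i => ?_)
    rw [abs_pow]
    exact pow_le_one₀ (abs_nonneg _) (hs i)
  have hdev : ∫ s, D s * (y s - 1 / 2) * (A' s - A s) ∂Q = X := by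
    have h1 : ∫ s, D s * (y s - 1 / 2) * (A' s - A s) ∂Q
        = ∫ s, D s * (y s - 1 / 2) * (hindsightInd opt j s - A s) ∂Q := by
      simp only [mul_sub (_ * _)]
      rw [integral_sub ((memLp_top_mul hw hA').integrable le_top)
        ((memLp_top_mul hw hA).integrable le_top), integral_sub
        ((memLp_top_mul hw (hone _ Q)).integrable le_top)
        ((memLp_top_mul hw hA).integrable le_top)]
      congr 1
      exact integral_mul_condExp_historyAlg hwm hw (hone _ Q)
    have hdiff : MemLp (fun s => hindsightInd opt j s - A s) ⊤ Q := (hone _ Q).sub hA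
    rw [h1, hp.integral_playStep ((memLp_top_mul hw hdiff).integrable le_top)]
    refine Finset.sum_congr rfl fun i _ => ?_
    have hpd : MemLp (fun s => p i s * d i s) ⊤ P := memLp_top_mul (hp.memLp i) (hdP i)
    have hpdm : Measurable[historyAlg T K n] fun s => p i s * d i s :=
      Measurable.mul (hp.measurable i) (hdm i)
    have hpda : MemLp (fun s => p i s * d i s * a s) ⊤ P :=
      memLp_top_mul hpd (memLp_posterior P opt j)
    have e1 := integral_mul_condExp_historyAlg hpdm hpd (memLp_lossAt_mul_hindsightInd P opt j i)
    have hpdam : Measurable[historyAlg T K n] fun s => p i s * d i s * a s :=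
      Measurable.mul hpdm (measurable_posterior P opt j)
    have e2 := integral_mul_condExp_historyAlg hpdam hpda (memLp_lossAt P n i)
    have e3 := integral_mul_condExp_historyAlg hpdm hpd (hone _ P)
    have i1 := (memLp_top_mul hpd (memLp_lossAt_mul_hindsightInd P opt j i)).integrable le_top
    have i2 := (memLp_top_mul hpda (memLp_lossAt P n i)).integrable le_top
    have i3 := (memLp_top_mul hpd (hone _ P)).integrable le_top
    have i4 := hpda.integrable le_top
    have i5 := (memLp_top_mul hpd
      ((memLp_lossAt_mul_hindsightInd P opt j i).condExp (m := historyAlg T K n)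
        le_top)).integrable le_top
    have i6 := (memLp_top_mul hpda
      ((memLp_lossAt P n i).condExp (m := historyAlg T K n) le_top)).integrable le_top
    have i7 : Integrable (fun s => p i s * d i s * (lossAt s.1 n (gridPoint K i)
        * hindsightInd opt j s) - p i s * d i s * a s * lossAt s.1 n (gridPoint K i)) P := i1.sub i2
    have i8 : Integrable (fun s => 1 / 2 *
        (p i s * d i s * hindsightInd opt j s - p i s * d i s * a s)) P := (i3.sub i4).const_mul _
    calc ∫ s, p i s * (D (appendPlay i s) * (y (appendPlay i s) - 1 / 2)
          * (hindsightInd opt j (appendPlay i s) - A (appendPlay i s))) ∂P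
        = ∫ s, ((p i s * d i s * (lossAt s.1 n (gridPoint K i) * hindsightInd opt j s)
            - p i s * d i s * a s * lossAt s.1 n (gridPoint K i))
            - 1 / 2 * (p i s * d i s * hindsightInd opt j s - p i s * d i s * a s)) ∂P := by
          refine integral_congr_ae (ae_of_all _ fun s => ?_)
          have h3 : hindsightInd opt j (appendPlay i s) = hindsightInd opt j s := rfl
          simp only [hyapp, h3]
          simp only [D, A, appendPlay_last, dropLast_appendPlay]
          ring
      _ = _ := by
          rw [integral_sub i7 i8, integral_sub i1 i2,
            integral_const_mul, integral_sub i3 i4, ← e1, ← e2, ← e3]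
          change _ - _ - 1 / 2 * (∫ s, p i s * d i s * a s ∂P - _) = _
          rw [sub_self, mul_zero, sub_zero, ← integral_sub i5 i6]
          refine integral_congr_ae ((posterior_mul_meanLossGiven (P := P) opt).mono fun s hs => ?_)
          simp only [← hs j i, d]
          change _ - _ * a s * meanLoss P i s = _
          ring
  have hmarg : ∀ g : ℝ → ℝ, Measurable g → ∫ s, g (A s) ∂Q = ∫ s, g (a s) ∂P := fun g hg =>
    hp.integral_dropLast (g := fun s => g (a s)) (hg.comp
      (Measurable.of_historyAlg (measurable_posterior P opt j))).aestronglyMeasurable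
  have hmean : ∫ s, A' s ∂Q = ∫ s, A s ∂Q := by
    simpa using hp.integral_mul_posterior opt j (φ := fun _ _ => 1) (C := 1)
      (fun _ => measurable_const) (by simp)
  have hAae : ∀ᵐ s ∂Q, A s ∈ Set.Icc (0 : ℝ) 1 :=
    hp.ae_dropLast ((posterior_mem_Icc opt).mono fun s hs => hs j)
  have hA'ae : ∀ᵐ s ∂Q, A' s ∈ Set.Icc (0 : ℝ) 1 :=
    (posterior_mem_Icc opt).mono fun s hs => hs j
  have hDae : ∀ᵐ s ∂Q, |D s| ≤ 1 := (hp.ae_dropLast hdb).mono fun s hs => hs _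
  refine le_of_forall_pos_le_add fun δ' hδ' => ?_
  obtain ⟨δ, hδ, hδ1, hδδ'⟩ : ∃ δ : ℝ, 0 < δ ∧ δ ≤ 1 ∧ 5 / 2 * δ ≤ δ' :=
    ⟨min 1 (δ' / (5 / 2)), lt_min one_pos (by positivity), min_le_left _ _, by
      have := min_le_right 1 (δ' / (5 / 2))
      linarith⟩
  -- The shift by `δ` bounds the logarithm, so that all integrals below exist.
  have hlogb : ∀ x ∈ Set.Icc (0 : ℝ) 1, |Real.log (x + δ)| ≤ |Real.log δ| + 1 := fun x hx => by
    have h1 := Real.log_le_log hδ (by linarith [hx.1] : δ ≤ x + δ)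
    have h2 := Real.log_le_sub_one_of_pos (by linarith [hx.1] : 0 < x + δ)
    have h3 := neg_abs_le (Real.log δ)
    exact abs_le.2 ⟨by linarith, by linarith [hx.2, abs_nonneg (Real.log δ)]⟩
  have hlogm : Measurable[historyAlg T K n] fun s => Real.log (a s + δ) :=
    Real.measurable_log.comp (Measurable.add (measurable_posterior P opt j) measurable_const)
  have hlogae : ∀ᵐ s ∂P, ∀ _ : Fin K, |Real.log (a s + δ)| ≤ |Real.log δ| + 1 :=
    (posterior_mem_Icc opt).mono fun s hs _ => hlogb _ (hs j)
  have hlogQ : MemLp (fun s => Real.log (A s + δ)) ⊤ Q :=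
    hp.memLp_lastArm (φ := fun _ s => Real.log (a s + δ)) (fun _ => hlogm) hlogae
  have hlog : ∫ s, A' s * Real.log (A s + δ) ∂Q = ∫ s, A s * Real.log (A s + δ) ∂Q := by
    simpa only [mul_comm] using hp.integral_mul_posterior opt j
      (φ := fun _ s => Real.log (a s + δ)) (fun _ => hlogm) hlogae
  have hloga : -∫ s, A s * Real.log (A s + δ) ∂Q ≤ ∫ s, Real.negMulLog (a s) ∂P := by
    rw [← hmarg _ Real.continuous_negMulLog.measurable, ← integral_neg]
    refine integral_mono_ae ((memLp_top_mul hA hlogQ).integrable le_top).neg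
      ((hp.memLp_dropLast (memLp_negMulLog_posterior P opt j)).integrable le_top)
      (hAae.mono fun s hs => ?_)
    simp only [Real.negMulLog]
    rcases hs.1.eq_or_lt with h | h
    · simp [← h]
    · have := mul_le_mul_of_nonneg_left
        (Real.log_le_log h (by linarith : A s ≤ A s + δ)) h.le
      linarith
  have hent : Integrable (fun s => Real.negMulLog (A' s)) Q :=
    (memLp_negMulLog_posterior Q opt j).integrable le_top
  have j1 := (memLp_top_mul hA' hlogQ).integrable le_top
  have j2 := hA'.integrable le_top
  have j3 := hA.integrable le_top
  have j4 := (memLp_top_mul hD2 hA').integrable le_top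
  have j5 := (memLp_top_mul hD2 hA).integrable le_top
  have k1 : Integrable (fun s => -Real.negMulLog (A' s)) Q := hent.neg
  have k2 : Integrable (fun s => -Real.negMulLog (A' s) - A' s * Real.log (A s + δ)) Q := k1.sub j1
  have k3 : Integrable (fun s => -Real.negMulLog (A' s) - A' s * Real.log (A s + δ) - A' s) Q :=
    k2.sub j2
  have k4 : Integrable (fun s => 1 / 2 *
      (-Real.negMulLog (A' s) - A' s * Real.log (A s + δ) - A' s + A s)) Q := (k3.add j3).const_mul _
  have k5 : Integrable (fun s => 1 / 4 * (D s ^ 2 * A' s + D s ^ 2 * A s)) Q :=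
    (j4.add j5).const_mul _
  have k6 : Integrable (fun s => 1 / 2 *
      (-Real.negMulLog (A' s) - A' s * Real.log (A s + δ) - A' s + A s)
      + 1 / 4 * (D s ^ 2 * A' s + D s ^ 2 * A s)) Q := k4.add k5
  have hle : ∫ s, D s * (y s - 1 / 2) * (A' s - A s) ∂Q
      ≤ ∫ s, (1 / 2 * (-Real.negMulLog (A' s) - A' s * Real.log (A s + δ) - A' s + A s)
        + 1 / 4 * (D s ^ 2 * A' s + D s ^ 2 * A s) + 5 / 4 * δ) ∂Q := by
    refine integral_mono_ae ((memLp_top_mul hw (hA'.sub hA)).integrable le_top)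
      (k6.add (integrable_const _)) ?_
    filter_upwards [hAae, hA'ae, hDae] with s h1 h2 h3
    exact deviation_mul_le h1.1 h2.1 h3 (hy s) hδ
  rw [hdev, integral_add k6 (integrable_const _), integral_add k4 k5, integral_const_mul,
    integral_const_mul, integral_add k3 j3, integral_sub k2 j2, integral_sub k1 j1, integral_neg,
    integral_add j4 j5, hX, hX', hlog, hmean, integral_const] at hle
  simp only [probReal_univ, one_smul] at hle
  linarith

/-- The expected information revealed by one round is at most the decrease of the expected entropy
of the posterior. -/
theorem IsStrategy.integral_roundInfo_le (hp : IsStrategy P p) (opt : ArgminRule K) :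
    ∫ s, roundInfo P p opt s ∂P ≤ posteriorEntropy P opt - posteriorEntropy (playStep P p) opt := by
  have hQ := hp.isProbabilityMeasure
  have hint : ∀ i j, Integrable (fun s => p i s * (posterior P opt j s
      * (meanLossGiven P opt j i s - meanLoss P i s) ^ 2)) P := fun i j => by
    have h := memLp_meanLossGiven_sub_meanLoss P opt j i
    simpa only [sq] using (memLp_top_mul (hp.memLp i) (memLp_top_mul (memLp_posterior P opt j)
      (memLp_top_mul h h))).integrable le_top
  unfold posteriorEntropy roundInfo
  rw [integral_finsetSum _ fun j _ => (memLp_negMulLog_posterior P opt j).integrable le_top,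
    integral_finsetSum _ fun j _ => (memLp_negMulLog_posterior _ opt j).integrable le_top,
    ← Finset.sum_sub_distrib]
  simp only [Finset.mul_sum]
  rw [integral_finsetSum _ fun i _ => integrable_finsetSum _ fun j _ => hint i j,
    Finset.sum_congr rfl fun i _ => integral_finsetSum _ fun j _ => hint i j, Finset.sum_comm]
  exact Finset.sum_le_sum fun j _ => hp.integral_info_le opt j

end Round

/-! ### The regret of the whole game -/

theorem measurable_lossAt_comp {T K n : ℕ} (m : ℕ) {φ : State T K n → Fin K} (hφ : Measurable φ) :
    Measurable fun s => lossAt s.1 m (gridPoint K (φ s)) := by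
  have h : Measurable fun x : Fin K × (Fin T → ConvexLoss) => lossAt x.2 m (gridPoint K x.1) :=
    measurable_from_prod_countable_right fun i => measurable_lossAt m i
  exact h.comp (hφ.prodMk measurable_fst)

theorem memLp_lossAt_comp {T K n : ℕ} (P : Measure (State T K n)) (m : ℕ) {φ : State T K n → Fin K}
    (hφ : Measurable φ) : MemLp (fun s => lossAt s.1 m (gridPoint K (φ s))) ⊤ P :=
  memLp_top_of_mem_Icc (measurable_lossAt_comp m hφ).aestronglyMeasurable
    (ae_of_all _ fun s => lossAt_mem_Icc s.1 m _)

/-- The regret of the rounds that have been played. -/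
def pastRegret {T K n : ℕ} (opt : ArgminRule K) (s : State T K n) : ℝ :=
  ∑ t : Fin n,
    (lossAt s.1 t (gridPoint K (s.2 t).1) - lossAt s.1 t (gridPoint K (hindsight opt s.1)))

theorem memLp_pastRegret {T K n : ℕ} (P : Measure (State T K n)) (opt : ArgminRule K) :
    MemLp (pastRegret opt) ⊤ P :=
  memLp_finsetSum _ fun t _ =>
    (memLp_lossAt_comp P t (measurable_fst.comp ((measurable_pi_apply t).comp measurable_snd))).sub
    (memLp_lossAt_comp P t ((measurable_hindsight opt).comp measurable_fst))

/-- The regret of the coming round, given the history, when the arms are played with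
probabilities `p`. -/
def roundRegret {T K n : ℕ} (P : Measure (State T K n)) (p : Fin K → State T K n → ℝ)
    (opt : ArgminRule K) (s : State T K n) : ℝ :=
  ∑ i, p i s * meanLoss P i s - ∑ j, posterior P opt j s * meanLossGiven P opt j j s

section Round

variable {T K n : ℕ} {P : Measure (State T K n)} [IsProbabilityMeasure P]
  {p : Fin K → State T K n → ℝ}

theorem memLp_meanLossGiven (P : Measure (State T K n)) [IsProbabilityMeasure P]
    (opt : ArgminRule K) (j i : Fin K) : MemLp (meanLossGiven P opt j i) ⊤ P :=
  memLp_top_of_mem_Icc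
    (Measurable.of_historyAlg (measurable_meanLossGiven P opt j i)).aestronglyMeasurable
    ((meanLossGiven_mem_Icc opt).mono fun _ hs => hs j i)

theorem IsStrategy.integrable_roundRegret (hp : IsStrategy P p) (opt : ArgminRule K) :
    Integrable (roundRegret P p opt) P :=
  (integrable_finsetSum _ fun i _ =>
    (memLp_top_mul (hp.memLp i) ((memLp_lossAt P n i).condExp le_top)).integrable le_top).sub
  (integrable_finsetSum _ fun j _ =>
    (memLp_top_mul (memLp_posterior P opt j) (memLp_meanLossGiven P opt j j)).integrable le_top)

theorem IsStrategy.integrable_roundInfo (hp : IsStrategy P p) (opt : ArgminRule K) :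
    Integrable (roundInfo P p opt) P :=
  (memLp_finsetSum _ fun i _ => memLp_top_mul (hp.memLp i) <| memLp_finsetSum _ fun j _ => by
    have h := memLp_meanLossGiven_sub_meanLoss P opt j i
    simpa only [sq] using memLp_top_mul (memLp_posterior P opt j)
      (memLp_top_mul h h)).integrable le_top

theorem IsStrategy.integral_pastRegret (hp : IsStrategy P p) (opt : ArgminRule K) :
    ∫ s, pastRegret opt s ∂(playStep P p)
      = ∫ s, pastRegret opt s ∂P + ∫ s, roundRegret P p opt s ∂P := by
  have hQ := hp.isProbabilityMeasure
  set Q := playStep P p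
  have hlast : MemLp (fun s : State T K (n + 1) =>
      lossAt s.1 n (gridPoint K (s.2 (Fin.last n)).1)) ⊤ Q :=
    memLp_lossAt_comp Q n (measurable_fst.comp ((measurable_pi_apply _).comp measurable_snd))
  have hhind : MemLp (fun s : State T K n => lossAt s.1 n (gridPoint K (hindsight opt s.1))) ⊤ P :=
    memLp_lossAt_comp P n ((measurable_hindsight opt).comp measurable_fst)
  have hhindQ := hp.memLp_dropLast hhind
  have hdiff : Integrable (fun s : State T K (n + 1) =>
      lossAt s.1 n (gridPoint K (s.2 (Fin.last n)).1)
        - lossAt (dropLast s).1 n (gridPoint K (hindsight opt (dropLast s).1))) Q :=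
    (hlast.integrable le_top).sub (hhindQ.integrable le_top)
  have hpast := hp.memLp_dropLast (memLp_pastRegret P opt)
  have hsplit : ∀ s : State T K (n + 1), pastRegret opt s = pastRegret opt (dropLast s)
      + (lossAt s.1 n (gridPoint K (s.2 (Fin.last n)).1)
        - lossAt (dropLast s).1 n (gridPoint K (hindsight opt (dropLast s).1))) := fun s => by
    unfold pastRegret
    rw [Fin.sum_univ_castSucc]
    rfl
  simp only [hsplit]
  rw [integral_add (hpast.integrable le_top) hdiff,
    integral_sub (hlast.integrable le_top) (hhindQ.integrable le_top),
    hp.integral_dropLast (memLp_pastRegret P opt).aestronglyMeasurable,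
    hp.integral_dropLast (g := fun s => lossAt s.1 n (gridPoint K (hindsight opt s.1)))
      hhind.aestronglyMeasurable, hp.integral_playStep (hlast.integrable le_top)]
  congr 1
  have hmul : ∀ i, MemLp (fun s => p i s * meanLoss P i s) ⊤ P := fun i =>
    memLp_top_mul (hp.memLp i) ((memLp_lossAt P n i).condExp le_top)
  have hmul' : ∀ j, MemLp (fun s => posterior P opt j s * meanLossGiven P opt j j s) ⊤ P := fun j =>
    memLp_top_mul (memLp_posterior P opt j) (memLp_meanLossGiven P opt j j)
  unfold roundRegret
  rw [integral_sub (integrable_finsetSum _ fun i _ => (hmul i).integrable le_top)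
      (integrable_finsetSum _ fun j _ => (hmul' j).integrable le_top),
    integral_finsetSum _ fun i _ => (hmul i).integrable le_top,
    integral_finsetSum _ fun j _ => (hmul' j).integrable le_top]
  congr 1
  · refine Finset.sum_congr rfl fun i _ => ?_
    simp only [appendPlay_last]
    exact (integral_mul_condExp_historyAlg (hp.measurable i) (hp.memLp i) (memLp_lossAt P n i)).symm
  · have h1 : ∀ s : State T K n, lossAt s.1 n (gridPoint K (hindsight opt s.1))
        = ∑ j, lossAt s.1 n (gridPoint K j) * hindsightInd opt j s := fun s => by
      simp [hindsightInd]
    simp only [h1]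
    rw [integral_finsetSum _ fun j _ =>
      (memLp_lossAt_mul_hindsightInd P opt j j).integrable le_top]
    refine Finset.sum_congr rfl fun j _ => ?_
    rw [← integral_condExp (historyAlg_le T K n)]
    exact integral_congr_ae ((posterior_mul_meanLossGiven opt).mono fun s hs => (hs j j).symm)

end Round

theorem sum_negMulLog_le_log {K : ℕ} {α : Fin K → ℝ} (h0 : ∀ i, 0 ≤ α i) (h1 : ∑ i, α i = 1) :
    ∑ i, Real.negMulLog (α i) ≤ Real.log K := by
  have hK : 0 < K := by
    rcases K.eq_zero_or_pos with rfl | h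
    · simp at h1
    · exact h
  have hK0 : (0 : ℝ) < K := by exact_mod_cast hK
  have h : ∀ i, Real.negMulLog (α i) ≤ α i * Real.log K + (1 / K - α i) := fun i => by
    rcases (h0 i).eq_or_lt with h | h
    · simp [← h]
    · have h2 := Real.log_le_sub_one_of_pos (show 0 < 1 / (K * α i) by positivity)
      rw [one_div, Real.log_inv, Real.log_mul hK0.ne' h.ne'] at h2
      have h3 := mul_le_mul_of_nonneg_left h2 h.le
      have h4 : α i * ((K * α i)⁻¹ - 1) = 1 / K - α i := by field_simp
      unfold Real.negMulLog
      linarith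
  calc ∑ i, Real.negMulLog (α i) ≤ ∑ i, (α i * Real.log K + (1 / K - α i)) :=
        Finset.sum_le_sum fun i _ => h i
    _ = Real.log K := by
        rw [Finset.sum_add_distrib, Finset.sum_sub_distrib, ← Finset.sum_mul, h1, Finset.sum_const,
          Finset.card_univ, Fintype.card_fin, nsmul_eq_mul, mul_one_div_cancel hK0.ne']
        ring

theorem posteriorEntropy_le_log {T K n : ℕ} (P : Measure (State T K n)) [IsProbabilityMeasure P]
    (opt : ArgminRule K) : posteriorEntropy P opt ≤ Real.log K := by
  have h := integral_mono_ae (integrable_finsetSum Finset.univ fun j _ =>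
      (memLp_negMulLog_posterior P opt j).integrable le_top) (integrable_const (Real.log K)) (by
    filter_upwards [posterior_mem_Icc (P := P) opt, sum_posterior (P := P) opt] with s h0 h1
    exact sum_negMulLog_le_log (fun i => (h0 i).1) h1)
  rwa [integral_const, probReal_univ, one_smul] at h

theorem posteriorEntropy_nonneg {T K n : ℕ} (P : Measure (State T K n)) [IsProbabilityMeasure P]
    (opt : ArgminRule K) : 0 ≤ posteriorEntropy P opt :=
  integral_nonneg_of_ae <| (posterior_mem_Icc (P := P) opt).mono fun _ hs =>
    Finset.sum_nonneg fun j _ => (negMulLog_mem_Icc (hs j)).1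

theorem roundRegret_le {T K n : ℕ} (P : Measure (State T K n)) [IsProbabilityMeasure P] {ε : ℝ}
    (hε : 0 < ε) (hε1 : ε ≤ 1) (opt best : ArgminRule K) {η : ℝ} (hη : 0 < η) :
    ∀ᵐ s ∂P, roundRegret P (playProb P ε opt best) opt s
      ≤ ε + √(45 * Real.log (2 * K / ε)) * ε + η / 2
        + 45 * Real.log (2 * K / ε) / (2 * η) * roundInfo P (playProb P ε opt best) opt s := by
  classical
  filter_upwards [posterior_mem_Icc (P := P) opt, sum_posterior (P := P) opt,
    meanLoss_mem_Icc (P := P), meanLossGiven_mem_Icc (P := P) opt, gridConvex_meanLoss (P := P),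
    gridConvex_meanLossGiven (P := P) opt] with s hα hα1 hf hg hfc hgc
  exact regret_le_information (f := fun i => meanLoss P i s)
    (g := fun j i => meanLossGiven P opt j i s) (b := bestArm P best s) hε hε1
    (fun i => (hα i).1) hα1 hf hg hfc hgc (fun i => best.sel_le (fun i => meanLoss P i s) i)
    (S := exploreSet P ε opt best s) (fun i => by simp [exploreSet])
    (fun i => by unfold playProb; congr) hη

section Game

variable {T K : ℕ} {prior : Measure (Fin T → ConvexLoss)} {ε : ℝ}
  {opt : ArgminRule K} {best : ℕ → ArgminRule K}

theorem gameLaw_succ (n : ℕ) : gameLaw prior ε opt best (n + 1)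
    = playStep (gameLaw prior ε opt best n)
      (playProb (gameLaw prior ε opt best n) ε opt (best n)) := rfl

theorem bayesRegret_eq : bayesRegret prior ε opt best
    = ∫ s, pastRegret opt s ∂(gameLaw prior ε opt best T) := by
  unfold bayesRegret pastRegret
  refine integral_congr_ae (ae_of_all _ fun s => ?_)
  simp only [lossAt, Fin.is_lt, dite_true, Fin.eta, Finset.sum_sub_distrib]

variable [IsProbabilityMeasure prior]

theorem isProbabilityMeasure_gameLaw (n : ℕ) :
    IsProbabilityMeasure (gameLaw prior ε opt best n) := by
  induction n with
  | zero =>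
    exact Measure.isProbabilityMeasure_map (measurable_id.prodMk measurable_const).aemeasurable
  | succ n ih => exact (isStrategy_playProb ε opt (best n)).isProbabilityMeasure

/-- The regret so far plus a multiple of the remaining entropy grows by a constant each round. -/
theorem integral_pastRegret_gameLaw_le (hε : 0 < ε) (hε1 : ε ≤ 1) (hK : 1 ≤ K) {η : ℝ} (hη : 0 < η)
    (n : ℕ) :
    ∫ s, pastRegret opt s ∂(gameLaw prior ε opt best n)
      + 45 * Real.log (2 * K / ε) / (2 * η) * posteriorEntropy (gameLaw prior ε opt best n) opt
      ≤ n * (ε + √(45 * Real.log (2 * K / ε)) * ε + η / 2)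
        + 45 * Real.log (2 * K / ε) / (2 * η) * Real.log K := by
  have hc : 0 ≤ 45 * Real.log (2 * K / ε) / (2 * η) := by
    have hK' : (1 : ℝ) ≤ K := by exact_mod_cast hK
    have := Real.log_nonneg (show 1 ≤ 2 * K / ε by rw [one_le_div hε]; linarith)
    positivity
  induction n with
  | zero =>
    have := isProbabilityMeasure_gameLaw (prior := prior) (ε := ε) (opt := opt) (best := best) 0
    have h := mul_le_mul_of_nonneg_left
      (posteriorEntropy_le_log (gameLaw prior ε opt best 0) opt) hc
    simpa [pastRegret] using h
  | succ n ih =>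
    have hP := isProbabilityMeasure_gameLaw (prior := prior) (ε := ε) (opt := opt) (best := best) n
    rw [gameLaw_succ]
    set P := gameLaw prior ε opt best n
    have hp : IsStrategy P (playProb P ε opt (best n)) := isStrategy_playProb ε opt (best n)
    rw [hp.integral_pastRegret opt]
    have hinfo := (hp.integrable_roundInfo opt).const_mul (45 * Real.log (2 * K / ε) / (2 * η))
    have h1 := integral_mono_ae (hp.integrable_roundRegret opt)
      (g := fun s => ε + √(45 * Real.log (2 * K / ε)) * ε + η / 2 + 45 * Real.log (2 * K / ε)
        / (2 * η) * roundInfo P (playProb P ε opt (best n)) opt s)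
      ((integrable_const _).add hinfo) (roundRegret_le P hε hε1 opt (best n) hη)
    rw [integral_add (integrable_const _) hinfo, integral_const, probReal_univ, one_smul,
      integral_const_mul] at h1
    have h3 := mul_le_mul_of_nonneg_left (hp.integral_roundInfo_le opt) hc
    push_cast
    linarith

theorem bayesRegret_le (hε : 0 < ε) (hε1 : ε ≤ 1) (hK : 1 ≤ K) :
    bayesRegret prior ε opt best ≤ 10 * √(T : ℝ) * Real.log (2 * K / ε)
      + 10 * ε * T * √(Real.log (2 * K / ε)) := by
  have hK' : (1 : ℝ) ≤ K := by exact_mod_cast hK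
  have hlog2 := Real.log_two_gt_d9
  have h2K : 2 ≤ 2 * K / ε := by rw [le_div_iff₀ hε]; nlinarith
  have hL2 : Real.log 2 ≤ Real.log (2 * K / ε) := Real.log_le_log two_pos h2K
  have hlogK : Real.log K ≤ Real.log (2 * K / ε) :=
    Real.log_le_log (by linarith) (by rw [le_div_iff₀ hε]; nlinarith)
  have hmain := fun η (hη : (0 : ℝ) < η) => integral_pastRegret_gameLaw_le
    (prior := prior) (opt := opt) (best := best) hε hε1 hK hη T
  rw [bayesRegret_eq]
  set L := Real.log (2 * K / ε)
  have hL : 0 < L := by linarith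
  have hP := isProbabilityMeasure_gameLaw (prior := prior) (ε := ε) (opt := opt) (best := best) T
  have hent := posteriorEntropy_nonneg (gameLaw prior ε opt best T) opt
  rcases T.eq_zero_or_pos with rfl | hT
  · simp [pastRegret]
  have hT' : (0 : ℝ) < T := by exact_mod_cast hT
  have hsT : 0 < √(T : ℝ) := Real.sqrt_pos.2 hT'
  have hsTT : √(T : ℝ) ^ 2 = T := Real.sq_sqrt hT'.le
  -- This `η` balances `T * η / 2` against `45 * L * log K / (2 * η)` up to a constant factor.
  have h := hmain (7 * L / √(T : ℝ)) (by positivity)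
  have e1 : 45 * L / (2 * (7 * L / √(T : ℝ))) = 45 / 14 * √(T : ℝ) := by field_simp; norm_num
  have e2 : (T : ℝ) * (7 * L / √(T : ℝ) / 2) = 7 / 2 * √(T : ℝ) * L := by
    nth_rw 1 [← hsTT]; field_simp
  rw [e1] at h
  have h1 : 0 ≤ 45 / 14 * √(T : ℝ) * posteriorEntropy (gameLaw prior ε opt best T) opt := by
    positivity
  have h2 : 45 / 14 * √(T : ℝ) * Real.log K ≤ 45 / 14 * √(T : ℝ) * L :=
    mul_le_mul_of_nonneg_left hlogK (by positivity)
  have hsL : 0 ≤ √L := Real.sqrt_nonneg _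
  have hsLL : √L ^ 2 = L := Real.sq_sqrt hL.le
  have hs1 : 1 ≤ 5 / 4 * √L := by nlinarith
  have hs2 : √(45 * L) ≤ 7 * √L := by
    refine Real.sqrt_le_iff.2 ⟨by positivity, ?_⟩
    rw [mul_pow, hsLL]; linarith
  have hεT : 0 ≤ ε * T := by positivity
  have h3 : (T : ℝ) * (ε + √(45 * L) * ε) ≤ 10 * ε * T * √L := by
    have := mul_le_mul_of_nonneg_left (show 1 + √(45 * L) ≤ 10 * √L by linarith) hεT
    linarith
  have h4 : 0 ≤ √(T : ℝ) * L := by positivity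
  linarith

end Game

theorem one_le_gridSize {ε : ℝ} (hε : 0 < ε) : 1 ≤ gridSize ε :=
  Nat.one_le_ceil_iff.2 (by positivity)

theorem gridSize_one_div_sqrt (T : ℕ) : gridSize (1 / √(T : ℝ)) = T := by
  unfold gridSize
  rw [div_pow, one_pow, Real.sq_sqrt (Nat.cast_nonneg T), one_div_one_div, Nat.ceil_natCast]

end ConvexBandit

end

theorem mainTheorem3 :
    (∀ (T : ℕ) (prior : Measure (Fin T → ConvexBandit.ConvexLoss)) (_ : IsProbabilityMeasure prior)
      (ε : ℝ) (_ : 0 < ε) (_ : ε ≤ 1)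
      (opt : ConvexBandit.ArgminRule (ConvexBandit.gridSize ε))
      (best : ℕ → ConvexBandit.ArgminRule (ConvexBandit.gridSize ε)),
      ConvexBandit.bayesRegret prior ε opt best
        ≤ 10 * √(T : ℝ) * Real.log (2 * (ConvexBandit.gridSize ε : ℝ) / ε)
          + 10 * ε * (T : ℝ) * √(Real.log (2 * (ConvexBandit.gridSize ε : ℝ) / ε))) ∧
    (∃ C : ℝ, ∀ (T : ℕ) (_ : 2 ≤ T)
      (prior : Measure (Fin T → ConvexBandit.ConvexLoss)) (_ : IsProbabilityMeasure prior)
      (opt : ConvexBandit.ArgminRule (ConvexBandit.gridSize (1 / √(T : ℝ))))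
      (best : ℕ → ConvexBandit.ArgminRule (ConvexBandit.gridSize (1 / √(T : ℝ)))),
      ConvexBandit.bayesRegret prior (1 / √(T : ℝ)) opt best ≤ C * √(T : ℝ) * Real.log (T : ℝ)) := by
  refine ⟨fun T prior _ ε hε hε1 opt best =>
    ConvexBandit.bayesRegret_le hε hε1 (ConvexBandit.one_le_gridSize hε), 55, ?_⟩
  intro T hT prior _ opt best
  have hT2 : (2 : ℝ) ≤ T := by exact_mod_cast hT
  have hT0 : (0 : ℝ) < T := by linarith
  have hs : 1 ≤ √(T : ℝ) := Real.one_le_sqrt.2 (by linarith)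
  have hs0 : 0 < √(T : ℝ) := by linarith
  have hε : 0 < 1 / √(T : ℝ) := by positivity
  have hsT : √(T : ℝ) ^ 2 = T := Real.sq_sqrt hT0.le
  refine (ConvexBandit.bayesRegret_le hε ((div_le_one hs0).2 hs)
    (ConvexBandit.one_le_gridSize hε)).trans ?_
  rw [ConvexBandit.gridSize_one_div_sqrt]
  have hlog : Real.log (2 * T / (1 / √(T : ℝ))) = Real.log 2 + 3 / 2 * Real.log T := by
    rw [div_div_eq_mul_div, div_one, Real.log_mul (by positivity) hs0.ne',
      Real.log_mul two_ne_zero hT0.ne', Real.log_sqrt hT0.le]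
    ring
  have hlog2 : Real.log 2 ≤ Real.log T := Real.log_le_log two_pos hT2
  have hlog2' := Real.log_two_gt_d9
  have hsqrt : √(Real.log 2 + 3 / 2 * Real.log T) ≤ 3 * Real.log T := by
    refine Real.sqrt_le_iff.2 ⟨by linarith, ?_⟩
    nlinarith
  have hε' : 10 * (1 / √(T : ℝ)) * T = 10 * √(T : ℝ) := by
    nth_rw 2 [← hsT]; field_simp
  rw [hlog, hε']
  have h1 : 10 * √(T : ℝ) * (Real.log 2 + 3 / 2 * Real.log T)
      ≤ 10 * √(T : ℝ) * (5 / 2 * Real.log T) :=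
    mul_le_mul_of_nonneg_left (by linarith) (by positivity)
  have h2 := mul_le_mul_of_nonneg_left hsqrt (show 0 ≤ 10 * √(T : ℝ) by positivity)
  linarith
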